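/- Let $M$ be a smooth ($C^\infty$, Hausdorff, second countable) manifold of dimension $2n$, let $\pi\colon FM\to M$ be its bundle of linear frames, let $G=\Delta GL(n,\mathbb R)=\{\operatorname{diag}(A,A): A\in GL(n,\mathbb R)\}\subset GL(2n,\mathbb R)$, and let $C(M)\to M$ be the bundle of linear connections, whose smooth sections over an open set $U\subseteq M$ are the linear connections on $U$. A smooth section $\sigma$ of $FM/G\to M$ over $U$ determines tensor fields $F_\sigma,P_\sigma$ of type $(1,1)$ on $U$ (an almost biparacomplex structure: $F_\sigma^2=P_\sigma^2=\mathrm{Id}$, $F_\sigma P_\sigma+P_\sigma F_\sigma=0$) by $$F_\sigma X_i=X_i,\quad F_\sigma Y_i=-Y_i,\quad P_\sigma X_i=Y_i,\quad P_\sigma Y_i=X_i$$ for every frame $(X_1,\dots,X_n,Y_1,\dots,Y_n)$ in the class $\sigma(x)$, $x\in U$. **Theorem.** For every open $U\subseteq M$ and every smooth section $\sigma$ of $FM/G\to M$ over $U$ there is exactly one linear connection $\nabla(\sigma)$ on $U$ (the canonical connection of $(F_\sigma,P_\sigma)$) with $\nabla F_\sigma=0=\nabla P_\sigma$ whose torsion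 satisfies $T(X,Y)=0$ whenever $X\in\ker(F_\sigma-\mathrm{Id})$ and $Y\in\ker(F_\sigma+\mathrm{Id})$. The assignment $\sigma\mapsto\nabla(\sigma)$ is a functorial connection of first order, that is: 0. it is a morphism of presheaves: $\nabla(\sigma|_V)=\nabla(\sigma)|_V$ for open $V\subseteq U$; 1. it is adapted: $\nabla(\sigma)$ is reducible to the $G$-structure $\mathcal B_\sigma=\{u\in FM : \pi(u)\in U,\ u\cdot G=\sigma(\pi(u))\}$; 2. it is natural: for every diffeomorphism $\varphi\colon U\to U'$ between open subsets of $M$ and every section $\sigma$ over $U$, $\nabla(\varphi\cdot\sigma)=\varphi\cdot\nabla(\sigma)$, where $\varphi\cdot\sigma$ is the section over $U'$ obtained by transporting frames by $\varphi_*$ and $\varphi\cdot\nabla(\sigma)$ is the direct image of the connection; 3. it factors smoothly through first jets: there is a smooth map $\nabla^1\colon J^1(FM/G)\to C(M)$ over $M$ with $\nabla(\sigma)(x)=\nabla^1(j^1_x\sigma)$ for all sections $\sigma$ over open sets $U$ and all $x\in U$. -/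

import Mathlib

open Set Filter Topology VectorField
open scoped Manifold ContDiff Matrix

noncomputable section

namespace Functorial

/-! Throughout, `M` is a smooth manifold without boundary modelled on the normed space `E`, and
`G` is a (closed) subgroup of `GL(ι, ℝ)`, where `ι` is an index type with `dim M` elements. -/

section Frames

variable {ι : Type*} [Fintype ι]
  {E : Type*} [NormedAddCommGroup E] [NormedSpace ℝ E]
  {M : Type*} [TopologicalSpace M] [ChartedSpace E M]

/-- A linear frame `(u₁, …, uₘ)` at `x`: a point of the frame bundle `FM` over `x`. -/
abbrev Frame (E : Type*) (ι : Type*) [NormedAddCommGroup E] [NormedSpace ℝ E]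
    {M : Type*} [TopologicalSpace M] [ChartedSpace E M] (x : M) : Type _ :=
  Module.Basis ι ℝ (TangentSpace 𝓘(ℝ, E) x)

/-- `u' = u · g`, the right action of a matrix on frames: `u'_j = ∑ i, g i j • u_i`. -/
def IsRightMul {x : M} (u : Frame E ι x) (g : Matrix ι ι ℝ) (u' : Frame E ι x) : Prop :=
  ∀ j, u' j = ∑ i, g i j • u i

theorem IsRightMul.trans {x : M} {u v w : Frame E ι x} {g h : Matrix ι ι ℝ}
    (h1 : IsRightMul u g v) (h2 : IsRightMul v h w) : IsRightMul u (g * h) w := by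
  intro j
  rw [h2 j]
  simp only [h1 _, Finset.smul_sum, smul_smul, Matrix.mul_apply, Finset.sum_smul]
  rw [Finset.sum_comm]
  exact Finset.sum_congr rfl fun i _ => Finset.sum_congr rfl fun k _ => by rw [mul_comm]

variable [DecidableEq ι]

theorem IsRightMul.one {x : M} (u : Frame E ι x) : IsRightMul u 1 u := by
  intro j
  simp [Matrix.one_apply, ite_smul]

theorem IsRightMul.inv {x : M} {u v : Frame E ι x} {g : GL ι ℝ}
    (h1 : IsRightMul u (g : Matrix ι ι ℝ) v) :
    IsRightMul v ((g⁻¹ : GL ι ℝ) : Matrix ι ι ℝ) u := by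
  intro j
  have key : ((g : Matrix ι ι ℝ) * ((g⁻¹ : GL ι ℝ) : Matrix ι ι ℝ)) = 1 := by
    rw [← Units.val_mul, mul_inv_cancel, Units.val_one]
  have h2 : ∑ i, ((g⁻¹ : GL ι ℝ) : Matrix ι ι ℝ) i j • v i
      = ∑ i, ((g : Matrix ι ι ℝ) * ((g⁻¹ : GL ι ℝ) : Matrix ι ι ℝ)) i j • u i := by
    simp only [h1 _, Finset.smul_sum, smul_smul, Matrix.mul_apply, Finset.sum_smul]
    rw [Finset.sum_comm]
    exact Finset.sum_congr rfl fun i _ => Finset.sum_congr rfl fun k _ => by rw [mul_comm]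
  rw [h2, key]
  simp [Matrix.one_apply, ite_smul]

/-- Frames at `x` modulo the right action of `G`. -/
def frameSetoid (E : Type*) [NormedAddCommGroup E] [NormedSpace ℝ E]
    {M : Type*} [TopologicalSpace M] [ChartedSpace E M] (G : Subgroup (GL ι ℝ)) (x : M) : Setoid (Frame E ι x) where
  r u u' := ∃ g ∈ G, IsRightMul u (g : Matrix ι ι ℝ) u'
  iseqv :=
    { refl := fun u => ⟨1, G.one_mem, by simpa using IsRightMul.one u⟩
      symm := fun ⟨g, hg, h⟩ => ⟨g⁻¹, G.inv_mem hg, h.inv⟩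
      trans := fun ⟨g, hg, h⟩ ⟨g', hg', h'⟩ =>
        ⟨g * g', G.mul_mem hg hg', by simpa using h.trans h'⟩ }

/-- The fibre over `x` of the quotient bundle `FM/G → M`. -/
def FrameQuot (E : Type*) [NormedAddCommGroup E] [NormedSpace ℝ E]
    {M : Type*} [TopologicalSpace M] [ChartedSpace E M] (G : Subgroup (GL ι ℝ)) (x : M) : Type _ := Quotient (frameSetoid E G x)

/-- The coset `u · G ∈ FM/G` of a frame `u ∈ FM`. -/
def coset (G : Subgroup (GL ι ℝ)) {x : M} (u : Frame E ι x) : FrameQuot E G x :=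
  Quotient.mk (frameSetoid E G x) u

end Frames

section Bundles

variable {ι : Type*} [Fintype ι] [DecidableEq ι]
  {E : Type*} [NormedAddCommGroup E] [NormedSpace ℝ E]
  {M : Type*} [TopologicalSpace M] [ChartedSpace E M] [IsManifold 𝓘(ℝ, E) ∞ M]

/-- The frame field `u` is smooth near `x` and projects there onto the section `s` of `FM/G → M`
over `U`; that is, `u` is near `x` a smooth section of the subbundle
`B_s = {u : u · G = s (π u)}` of `FM`. The values of `u` away from `x` are irrelevant. -/
def IsLiftNear {G : Subgroup (GL ι ℝ)} {U : TopologicalSpace.Opens M}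
    (s : (x : U) → FrameQuot E G (x : M)) (u : (y : M) → Frame E ι y) (x : M) : Prop :=
  ∃ (V : TopologicalSpace.Opens M) (hV : V ≤ U), x ∈ V ∧
    (∀ j, ContMDiffOn 𝓘(ℝ, E) 𝓘(ℝ, E).tangent ∞
      (fun y => (⟨y, u y j⟩ : TangentBundle 𝓘(ℝ, E) M)) V) ∧
    ∀ y : V, s ⟨y, hV y.2⟩ = coset G (u y)

/-- Smooth sections over `U` of `FM/G → M`, i.e. `G`-structures on `U`. The manifold structure of
`FM/G` is the one for which `FM → FM/G` is a submersion, so a section of `FM/G` is smooth exactly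
if it lifts locally to smooth sections of `FM`. -/
structure QuotSection (E : Type*) [NormedAddCommGroup E] [NormedSpace ℝ E]
    {M : Type*} [TopologicalSpace M] [ChartedSpace E M] [IsManifold 𝓘(ℝ, E) ∞ M] (G : Subgroup (GL ι ℝ)) (U : TopologicalSpace.Opens M) where
  toFun : (x : U) → FrameQuot E G (x : M)
  smooth : ∀ x : U, ∃ u : (y : M) → Frame E ι y, IsLiftNear toFun u (x : M)

/-- Restriction of a section to a smaller open set. -/
def QuotSection.restrict {G : Subgroup (GL ι ℝ)} {U V : TopologicalSpace.Opens M}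
    (s : QuotSection E G U) (h : V ≤ U) : QuotSection E G V where
  toFun x := s.toFun ⟨x, h x.2⟩
  smooth x := by
    obtain ⟨u, W, hW, hx, hu, hs⟩ := s.smooth ⟨x, h x.2⟩
    exact ⟨u, W ⊓ V, inf_le_right, ⟨hx, x.2⟩, fun j => (hu j).mono fun y hy => hy.1,
      fun y => hs ⟨y, y.2.1⟩⟩

/-- Coordinate expression, in a chart `e` of `M`, of a frame field `u`. -/
def frameCoord (e : OpenPartialHomeomorph M E) (u : (y : M) → Frame E ι y) (ξ : E) : ι → E :=
  fun j => mfderiv 𝓘(ℝ, E) 𝓘(ℝ, E) e (e.symm ξ) (u (e.symm ξ) j)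

/-- The coordinates, in the chart of `J¹(FM)` induced by the chart `e` of `M`, of the 1-jet at `x`
of the frame field `u`: base point, value and first derivative. -/
def jetCoord (e : OpenPartialHomeomorph M E) (u : (y : M) → Frame E ι y) (x : M) :
    E × (ι → E) × (E →L[ℝ] (ι → E)) :=
  (e x, frameCoord e u (e x), fderiv ℝ (frameCoord e u) (e x))

/-- The open set of `E × E^m × Hom(E, E^m)` on which the coordinates `jetCoord e` of `J¹(FM)`
range: points `(ξ, A, L)` with `ξ` in the image of the chart and `A` a frame. -/
def jetDomain (ι : Type*) [Fintype ι] (e : OpenPartialHomeomorph M E) :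
    Set (E × (ι → E) × (E →L[ℝ] (ι → E))) :=
  {p | p.1 ∈ e.target ∧ LinearIndependent ℝ p.2.1}

/-- Smooth sections of `FM/G → M` over open neighbourhoods of `x`. -/
structure LocalSection (E : Type*) [NormedAddCommGroup E] [NormedSpace ℝ E]
    {M : Type*} [TopologicalSpace M] [ChartedSpace E M] [IsManifold 𝓘(ℝ, E) ∞ M] (G : Subgroup (GL ι ℝ)) (x : M) where
  U : TopologicalSpace.Opens M
  mem : x ∈ U
  sec : QuotSection E G U

/-- Two local sections of `FM/G` have the same 1-jet at `x`: they have smooth lifts to `FM` near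
`x` with the same 1-jet at `x` (equivalently, the same value and differential at `x`, because
`FM → FM/G` is a submersion). -/
def SameJet (E : Type*) [NormedAddCommGroup E] [NormedSpace ℝ E]
    {M : Type*} [TopologicalSpace M] [ChartedSpace E M] [IsManifold 𝓘(ℝ, E) ∞ M] (G : Subgroup (GL ι ℝ)) (x : M) (s s' : LocalSection E G x) : Prop :=
  ∃ u u' : (y : M) → Frame E ι y, IsLiftNear s.sec.toFun u x ∧ IsLiftNear s'.sec.toFun u' x ∧
    jetCoord (chartAt E x) u x = jetCoord (chartAt E x) u' x

/-- The fibre over `x` of the 1-jet bundle `J¹(FM/G) → M`. -/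
def Jet (E : Type*) [NormedAddCommGroup E] [NormedSpace ℝ E]
    {M : Type*} [TopologicalSpace M] [ChartedSpace E M] [IsManifold 𝓘(ℝ, E) ∞ M] (G : Subgroup (GL ι ℝ)) (x : M) : Type _ := Quot (SameJet E G x)

/-- The 1-jet `j¹ₓ s`. -/
def QuotSection.jet {G : Subgroup (GL ι ℝ)} {U : TopologicalSpace.Opens M}
    (s : QuotSection E G U) (x : U) : Jet E G (x : M) :=
  Quot.mk _ ⟨U, x.2, s⟩

/-- The fibre over `x` of the bundle `C(M) → M` of linear connections. An element sends every
vector field `X` that is differentiable at `x` to the endomorphism `v ↦ ∇_v X` of `T_x M`, and it is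
additive and satisfies the Leibniz rule; hence `∇_v X` only depends on the 1-jet of `X` at `x`.
Vector fields that are not differentiable at `x` are sent to the conventional value `0`. -/
@[ext]
structure ConnAt (E : Type*) [NormedAddCommGroup E] [NormedSpace ℝ E]
    {M : Type*} [TopologicalSpace M] [ChartedSpace E M] [IsManifold 𝓘(ℝ, E) ∞ M] (x : M) where
  toFun : ((y : M) → TangentSpace 𝓘(ℝ, E) y) →
    TangentSpace 𝓘(ℝ, E) x →L[ℝ] TangentSpace 𝓘(ℝ, E) x
  add : ∀ {X Y : (y : M) → TangentSpace 𝓘(ℝ, E) y},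
    MDiffAt (T% X) x → MDiffAt (T% Y) x → toFun (X + Y) = toFun X + toFun Y
  leibniz : ∀ {X : (y : M) → TangentSpace 𝓘(ℝ, E) y} {f : M → ℝ},
    MDiffAt (T% X) x → MDiffAt f x →
    toFun (fun y => f y • X y) = f x • toFun X + (d% f x).smulRight (X x)
  junk : ∀ {X : (y : M) → TangentSpace 𝓘(ℝ, E) y}, ¬ MDiffAt (T% X) x → toFun X = 0

/-- The Christoffel symbol `Γ(v, w) = ∇_{∂_v} ∂_w` of a connection at `x` in the chart `e`, where
`∂_w` is the vector field that is constantly `w` in the chart. The base point and these symbols are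
the coordinates of `C(M)` induced by `e`. -/
def ConnAt.christoffel {x : M} (D : ConnAt E x) (e : OpenPartialHomeomorph M E) (v w : E) :
    E :=
  mfderiv 𝓘(ℝ, E) 𝓘(ℝ, E) e x
    (D.toFun (mpullback 𝓘(ℝ, E) 𝓘(ℝ, E) e (fun _ => w))
      (mpullback 𝓘(ℝ, E) 𝓘(ℝ, E) e (fun _ => v) x))

/-- A linear connection on the open set `U`: a smooth section of `C(M) → M` over `U`. -/
@[ext]
structure LinearConnection (E : Type*) [NormedAddCommGroup E] [NormedSpace ℝ E]
    {M : Type*} [TopologicalSpace M] [ChartedSpace E M] [IsManifold 𝓘(ℝ, E) ∞ M]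
    (U : TopologicalSpace.Opens M) where
  toFun : (x : U) → ConnAt E (x : M)
  smooth : ∀ e ∈ IsManifold.maximalAtlas 𝓘(ℝ, E) ∞ M, ∀ v w : E,
    ContMDiffOn 𝓘(ℝ, E) 𝓘(ℝ, E) ∞ (fun x : U => (toFun x).christoffel e v w)
      {x : U | (x : M) ∈ e.source}

/-- The Lie algebra of a closed linear group. -/
def lieAlgebra (G : Subgroup (GL ι ℝ)) : Set (Matrix ι ι ℝ) :=
  {a | ∀ t : ℝ, ∃ g ∈ G, (g : Matrix ι ι ℝ) = NormedSpace.exp (t • a)}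

/-- `D` is reducible to the subbundle `B_s` of `FM`: with respect to every local smooth section
`u` of `B_s`, the connection form `ω` of `D`, given by `∇_v u_j = ∑ i, ω(v)_{ij} u_i`, takes its
values in the Lie algebra of `G`. -/
def IsAdapted {G : Subgroup (GL ι ℝ)} {U : TopologicalSpace.Opens M}
    (s : QuotSection E G U) (D : LinearConnection E U) : Prop :=
  ∀ (x : U) (u : (y : M) → Frame E ι y), IsLiftNear s.toFun u (x : M) →
    ∀ v : TangentSpace 𝓘(ℝ, E) (x : M), ∃ a ∈ lieAlgebra G,
      ∀ j, (D.toFun x).toFun (fun y => u y j) v = ∑ i, a i j • u x i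

/-- The source of a diffeomorphism between open subsets of `M`. -/
def srcOpens (φ : OpenPartialHomeomorph M M) : TopologicalSpace.Opens M := ⟨_, φ.open_source⟩

/-- The target of a diffeomorphism between open subsets of `M`. -/
def tgtOpens (φ : OpenPartialHomeomorph M M) : TopologicalSpace.Opens M := ⟨_, φ.open_target⟩

/-- The image of a point of the source. -/
def imgPt (φ : OpenPartialHomeomorph M M) (x : srcOpens φ) : tgtOpens φ := ⟨φ x, φ.map_source x.2⟩

/-- `s' = φ · s`: the class of the frame `(u₁, …, uₘ)` at `x` is the value of `s` if and only if the
class of `(φ_* u₁, …, φ_* uₘ)` is the value of `s'` at `φ x`. -/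
def IsTransport {G : Subgroup (GL ι ℝ)} (φ : OpenPartialHomeomorph M M)
    (s : QuotSection E G (srcOpens φ)) (s' : QuotSection E G (tgtOpens φ)) : Prop :=
  ∀ (x : srcOpens φ) (u : Frame E ι (x : M)) (u' : Frame E ι (imgPt φ x : M)),
    (∀ j, u' j = mfderiv 𝓘(ℝ, E) 𝓘(ℝ, E) φ (x : M) (u j)) →
    (s.toFun x = coset G u ↔ s'.toFun (imgPt φ x) = coset G u')

/-- `D' = φ · D`: `∇'_{φ_* v} Y = φ_* (∇_v (φ^* Y))`, where `φ^* Y = (φ_*)⁻¹ ∘ Y ∘ φ`. -/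
def IsDirectImage (φ : OpenPartialHomeomorph M M)
    (D : LinearConnection E (srcOpens φ)) (D' : LinearConnection E (tgtOpens φ)) : Prop :=
  ∀ (x : srcOpens φ) (Y : (y : M) → TangentSpace 𝓘(ℝ, E) y),
    MDiffAt (T% Y) (imgPt φ x : M) → ∀ v : TangentSpace 𝓘(ℝ, E) (x : M),
      (D'.toFun (imgPt φ x)).toFun Y (mfderiv 𝓘(ℝ, E) 𝓘(ℝ, E) φ (x : M) v) =
        mfderiv 𝓘(ℝ, E) 𝓘(ℝ, E) φ (x : M)
          ((D.toFun x).toFun (mpullback 𝓘(ℝ, E) 𝓘(ℝ, E) φ Y) v)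

/-- A fibred map `J¹(FM/G) → C(M)` is smooth. The manifold structure of `J¹(FM/G)` is the one for
which the projection `J¹(FM) → J¹(FM/G)` is a surjective submersion, so smoothness means that the
composite `J¹(FM) → J¹(FM/G) → C(M)` is smooth; here this is expressed in the coordinates of
`J¹(FM)` and `C(M)` induced by the charts `e` of `M`. -/
def IsSmoothJetMap {G : Subgroup (GL ι ℝ)}
    (Φ : (x : M) → Jet E G x → ConnAt E x) : Prop :=
  ∀ e ∈ IsManifold.maximalAtlas 𝓘(ℝ, E) ∞ M, ∀ v w : E,
    ∃ Γ : E × (ι → E) × (E →L[ℝ] (ι → E)) → E,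
      ContDiffOn ℝ ∞ Γ (jetDomain ι e) ∧
      ∀ (U : TopologicalSpace.Opens M) (s : QuotSection E G U) (x : U)
        (u : (y : M) → Frame E ι y), (x : M) ∈ e.source → IsLiftNear s.toFun u (x : M) →
          (Φ x (s.jet x)).christoffel e v w = Γ (jetCoord e u (x : M))

/-- `∇` assigns to each section `s` of `FM/G → M` over each open subset a linear connection on that
subset, and this is a functorial connection that factors through first order jets. -/
structure IsFunctorialConnection {G : Subgroup (GL ι ℝ)}
    (nabla : (U : TopologicalSpace.Opens M) → QuotSection E G U → LinearConnection E U) :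
    Prop where
  /-- `∇` is a morphism of presheaves. -/
  restrict : ∀ {U V : TopologicalSpace.Opens M} (h : V ≤ U) (s : QuotSection E G U) (x : V),
    (nabla V (s.restrict h)).toFun x = (nabla U s).toFun ⟨x, h x.2⟩
  /-- `∇(s)` is adapted to the `G`-structure defined by `s`. -/
  adapted : ∀ {U : TopologicalSpace.Opens M} (s : QuotSection E G U), IsAdapted s (nabla U s)
  /-- `∇(φ · s) = φ · ∇(s)` for every diffeomorphism `φ : U → U'` between open subsets of `M`. -/
  natural : ∀ φ : OpenPartialHomeomorph M M,
    ContMDiffOn 𝓘(ℝ, E) 𝓘(ℝ, E) ∞ φ φ.source → ContMDiffOn 𝓘(ℝ, E) 𝓘(ℝ, E) ∞ φ.symm φ.target →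
    ∀ (s : QuotSection E G (srcOpens φ)) (s' : QuotSection E G (tgtOpens φ)),
      IsTransport φ s s' → IsDirectImage φ (nabla _ s) (nabla _ s')
  /-- `∇(s)(x) = ∇¹(j¹ₓ s)` for a smooth map `∇¹ : J¹(FM/G) → C(M)`. -/
  factors : ∃ nabla1 : (x : M) → Jet E G x → ConnAt E x,
    (∀ (U : TopologicalSpace.Opens M) (s : QuotSection E G U) (x : U),
      (nabla U s).toFun x = nabla1 x (s.jet x)) ∧ IsSmoothJetMap nabla1

end Bundles

section Biparacomplex

/-- The group `ΔGL(n, ℝ)` of the matrices `diag(A, A)`, `A ∈ GL(n, ℝ)`. -/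
def deltaGL (n : ℕ) : Subgroup (GL (Fin n ⊕ Fin n) ℝ) where
  carrier := {g | ∃ A : GL (Fin n) ℝ, (g : Matrix (Fin n ⊕ Fin n) (Fin n ⊕ Fin n) ℝ) =
    Matrix.fromBlocks (A : Matrix (Fin n) (Fin n) ℝ) 0 0 A}
  one_mem' := ⟨1, by simp⟩
  mul_mem' := by
    rintro g h ⟨A, hA⟩ ⟨B, hB⟩
    exact ⟨A * B, by simp [hA, hB, Matrix.fromBlocks_multiply]⟩
  inv_mem' := by
    rintro g ⟨A, hA⟩
    refine ⟨A⁻¹, Units.inv_eq_of_mul_eq_one_right ?_⟩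
    rw [hA, Matrix.fromBlocks_multiply]
    simp only [Matrix.zero_mul, Matrix.mul_zero, add_zero, zero_add]
    rw [← Units.val_mul, mul_inv_cancel, Units.val_one, Matrix.fromBlocks_one]

/-- The matrix of `F` in an adapted frame `(X₁, …, Xₙ, Y₁, …, Yₙ)`: `F X_i = X_i`, `F Y_i = -Y_i`. -/
def matF (n : ℕ) : Matrix (Fin n ⊕ Fin n) (Fin n ⊕ Fin n) ℝ := Matrix.fromBlocks 1 0 0 (-1)

/-- The matrix of `P` in an adapted frame `(X₁, …, Xₙ, Y₁, …, Yₙ)`: `P X_i = Y_i`, `P Y_i = X_i`. -/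
def matP (n : ℕ) : Matrix (Fin n ⊕ Fin n) (Fin n ⊕ Fin n) ℝ := Matrix.fromBlocks 0 1 1 0

variable {E : Type*} [NormedAddCommGroup E] [NormedSpace ℝ E]
  {M : Type*} [TopologicalSpace M] [ChartedSpace E M]

theorem toLin_congr {ι : Type*} [Fintype ι] [DecidableEq ι] {x : M} {u u' : Frame E ι x}
    {g a : Matrix ι ι ℝ} (h : IsRightMul u g u') (hc : a * g = g * a) :
    Matrix.toLin u u a = Matrix.toLin u' u' a := by
  refine u'.ext fun j => ?_
  rw [Matrix.toLin_self, h j, map_sum]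
  simp only [map_smul, Matrix.toLin_self, h _, Finset.smul_sum, smul_smul]
  rw [Finset.sum_comm, Finset.sum_comm (f := fun i k => (a i j * g k i) • u k)]
  refine Finset.sum_congr rfl fun k _ => ?_
  rw [← Finset.sum_smul, ← Finset.sum_smul]
  congr 1
  have := congrFun (congrFun hc k) j
  simp only [Matrix.mul_apply] at this
  simpa [mul_comm] using this

/-- The endomorphism of `T_x M` that has the matrix `a` in all frames of the class `q`, where `a`
commutes with `ΔGL(n, ℝ)`. -/
def endoOf {n : ℕ} (a : Matrix (Fin n ⊕ Fin n) (Fin n ⊕ Fin n) ℝ)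
    (ha : ∀ g ∈ deltaGL n, a * (g : Matrix _ _ ℝ) = (g : Matrix _ _ ℝ) * a) {x : M}
    (q : FrameQuot E (deltaGL n) x) :
    TangentSpace 𝓘(ℝ, E) x →ₗ[ℝ] TangentSpace 𝓘(ℝ, E) x :=
  Quotient.lift (s := frameSetoid E (deltaGL n) x) (fun u => Matrix.toLin u u a)
    (fun _ _ ⟨g, hg, h⟩ => toLin_congr h (ha g hg)) q

theorem matF_comm {n : ℕ} (g : GL (Fin n ⊕ Fin n) ℝ) (hg : g ∈ deltaGL n) :
    matF n * (g : Matrix _ _ ℝ) = (g : Matrix _ _ ℝ) * matF n := by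
  obtain ⟨A, hA⟩ := hg
  rw [hA, matF, Matrix.fromBlocks_multiply, Matrix.fromBlocks_multiply]
  simp

theorem matP_comm {n : ℕ} (g : GL (Fin n ⊕ Fin n) ℝ) (hg : g ∈ deltaGL n) :
    matP n * (g : Matrix _ _ ℝ) = (g : Matrix _ _ ℝ) * matP n := by
  obtain ⟨A, hA⟩ := hg
  rw [hA, matP, Matrix.fromBlocks_multiply, Matrix.fromBlocks_multiply]
  simp

variable [IsManifold 𝓘(ℝ, E) ∞ M] {U : TopologicalSpace.Opens M}

/-- A field of endomorphisms of the tangent spaces over `U` (a tensor field of type `(1,1)`). -/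
abbrev EndoField (E : Type*) [NormedAddCommGroup E] [NormedSpace ℝ E]
    {M : Type*} [TopologicalSpace M] [ChartedSpace E M] (U : TopologicalSpace.Opens M) : Type _ :=
  (x : U) → TangentSpace 𝓘(ℝ, E) (x : M) →ₗ[ℝ] TangentSpace 𝓘(ℝ, E) (x : M)

/-- The tensor field `F_σ` of the almost biparacomplex structure of `σ`. -/
def tensorF {n : ℕ} (s : QuotSection E (deltaGL n) U) : EndoField E U :=
  fun x => endoOf (matF n) matF_comm (s.toFun x)

/-- The tensor field `P_σ` of the almost biparacomplex structure of `σ`. -/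
def tensorP {n : ℕ} (s : QuotSection E (deltaGL n) U) : EndoField E U :=
  fun x => endoOf (matP n) matP_comm (s.toFun x)

/-- `(F_σ, P_σ)` is an almost biparacomplex structure. -/
theorem tensorF_tensorP {n : ℕ} (s : QuotSection E (deltaGL n) U) (x : U) :
    tensorF s x ∘ₗ tensorF s x = LinearMap.id ∧ tensorP s x ∘ₗ tensorP s x = LinearMap.id ∧
      tensorF s x ∘ₗ tensorP s x + tensorP s x ∘ₗ tensorF s x = 0 := by
  obtain ⟨u, hu⟩ := Quotient.exists_rep (s.toFun x)
  have hF : tensorF s x = Matrix.toLin u u (matF n) := by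
    unfold tensorF; rw [← hu]; rfl
  have hP : tensorP s x = Matrix.toLin u u (matP n) := by
    unfold tensorP; rw [← hu]; rfl
  rw [hF, hP, ← Matrix.toLin_mul, ← Matrix.toLin_mul, ← Matrix.toLin_mul, ← Matrix.toLin_mul,
    ← map_add]
  simp [matF, matP, Matrix.fromBlocks_multiply, Matrix.fromBlocks_add]

open Classical in
/-- The vector field `A X` on `U`, extended by zero. -/
def EndoField.act (A : EndoField E U) (X : (y : M) → TangentSpace 𝓘(ℝ, E) y) :
    (y : M) → TangentSpace 𝓘(ℝ, E) y :=
  fun y => if h : y ∈ U then A ⟨y, h⟩ (X y) else 0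

/-- `∇A = 0` on `U`, that is, `∇_v (A X) = A (∇_v X)`. -/
def IsParallel (D : LinearConnection E U) (A : EndoField E U) : Prop :=
  ∀ (x : U) (X : (y : M) → TangentSpace 𝓘(ℝ, E) y), MDiffAt (T% X) (x : M) →
    ∀ v, (D.toFun x).toFun (A.act X) v = A x ((D.toFun x).toFun X v)

/-- `D` is the canonical connection of the almost biparacomplex structure `(F, P)` on `U`:
`∇F = 0 = ∇P`, and the torsion `T(X, Y) = ∇_X Y - ∇_Y X - [X, Y]` vanishes if `X ∈ ker(F - id)` and
`Y ∈ ker(F + id)`. -/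
def IsCanonicalConnection (F P : EndoField E U) (D : LinearConnection E U) : Prop :=
  IsParallel D F ∧ IsParallel D P ∧
    ∀ (x : U) (X Y : (y : M) → TangentSpace 𝓘(ℝ, E) y),
      MDiffAt (T% X) (x : M) → MDiffAt (T% Y) (x : M) →
      F x (X x) = X x → F x (Y x) = -Y x →
      (D.toFun x).toFun Y (X x) - (D.toFun x).toFun X (Y x) - mlieBracket 𝓘(ℝ, E) X Y (x : M) = 0

end Biparacomplex

end Functorial

end

/-! Everything is local: near a point the section lifts to a smooth frame field `u = (X_i, Y_j)`, in
which `F` and `P` have constant matrices. Hence `∇F = 0 = ∇P` says exactly that the connection form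
of `∇` commutes with both matrices (`parallelAt_iff`), that is, has the form `diag(B, B)`
(`commute_matF_matP_iff`). Such matrices lie in the Lie algebra of `ΔGL(n, ℝ)`, which gives
adaptedness.

Torsion is tensorial, so its condition reduces to `∇_{X_i} Y_j - ∇_{Y_j} X_i = [X_i, Y_j]`. The
first term lies in the span of the `Y`s and the second in the span of the `X`s, so the equation
decouples: the `Y`-part of the bracket is `B(X_i)` applied to `Y_j`, and its `X`-part is minus
`B(Y_j)` applied to `X_i`. Thus `B` is prescribed on every frame vector with no further constraint
(`isCanonicalAt_iff`), whence existence and uniqueness at each point (`existsUnique_isCanonicalAt`).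
The defining conditions mention no frame, so the formula holds in every lift.

The remaining claims follow from this formula. The structure functions of `u` depend only on its
1-jet, so in a chart the Christoffel symbols are one smooth function of the jet
(`christoffel_eq_canonicalChristoffel`): this gives smoothness of `∇` and the factorization through
`J¹(FM/G)`. Diffeomorphisms preserve brackets, hence structure functions and connection forms
(`apply_mfderiv_of_connForm`): this gives naturality. -/

noncomputable section

namespace Functorial

/-! ### Coefficients with respect to a variable basis -/

section FrameCoeff

variable {ι : Type*} [Fintype ι]
  {E : Type*} [NormedAddCommGroup E] [NormedSpace ℝ E]

/-- The linear combinations `c ↦ ∑ i, c i • A i` of a family of vectors. -/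
def frameComb (A : ι → E) : (ι → ℝ) →L[ℝ] E :=
  ∑ i, (ContinuousLinearMap.proj (R := ℝ) (φ := fun _ : ι => ℝ) i).smulRight (A i)

theorem frameComb_apply (A : ι → E) (c : ι → ℝ) : frameComb A c = ∑ i, c i • A i := by
  simp [frameComb]

/-- The coefficients of vectors with respect to the family `A` (meaningful if `A` is a basis). -/
def frameCoeff (A : ι → E) : E →L[ℝ] (ι → ℝ) := (frameComb A).inverse

theorem contDiff_frameComb : ContDiff ℝ ∞ (frameComb : (ι → E) → _) := by
  unfold frameComb
  refine ContDiff.sum fun i _ => ?_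
  exact ((ContinuousLinearMap.smulRightL ℝ (ι → ℝ) E
    (ContinuousLinearMap.proj (R := ℝ) (φ := fun _ : ι => ℝ) i)).contDiff).comp
      (contDiff_apply ℝ E i)

theorem frameComb_basis (b : Module.Basis ι ℝ E) :
    frameComb b = (b.equivFun.symm.toContinuousLinearEquiv : (ι → ℝ) →L[ℝ] E) := by
  ext c
  simp [frameComb_apply]

theorem frameCoeff_basis (b : Module.Basis ι ℝ E) (w : E) : frameCoeff b w = b.repr w := by
  rw [frameCoeff, frameComb_basis, ContinuousLinearMap.inverse_equiv]
  rfl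

/-- `frameCoeff` is the linear dependence `A ↦ frameComb A` followed by inversion of operators,
which is smooth at invertible ones; so smoothness is available at bases. -/
theorem contDiffAt_frameCoeff (b : Module.Basis ι ℝ E) :
    ContDiffAt ℝ ∞ (frameCoeff : (ι → E) → _) b := by
  have h := contDiffAt_map_inverse (𝕜 := ℝ) (n := ∞) b.equivFun.symm.toContinuousLinearEquiv
  rw [← frameComb_basis] at h
  exact h.comp (b : ι → E) contDiff_frameComb.contDiffAt

end FrameCoeff

/-! ### Vector fields and brackets under diffeomorphisms -/

section Transport

variable {E : Type*} [NormedAddCommGroup E] [NormedSpace ℝ E]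
  {M : Type*} [TopologicalSpace M] [ChartedSpace E M]
  {N : Type*} [TopologicalSpace N] [ChartedSpace E N]

/-- A diffeomorphism between open subsets of two manifolds. -/
structure IsDiffeo (f : OpenPartialHomeomorph M N) : Prop where
  contMDiffOn : ContMDiffOn 𝓘(ℝ, E) 𝓘(ℝ, E) ∞ f f.source
  contMDiffOn_symm : ContMDiffOn 𝓘(ℝ, E) 𝓘(ℝ, E) ∞ f.symm f.target

namespace IsDiffeo

variable {f : OpenPartialHomeomorph M N} (hf : IsDiffeo (E := E) f) {x : M}
include hf

theorem symm : IsDiffeo (E := E) f.symm := ⟨hf.2, by simpa using hf.1⟩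

theorem contMDiffAt (hx : x ∈ f.source) : ContMDiffAt 𝓘(ℝ, E) 𝓘(ℝ, E) ∞ f x :=
  hf.1.contMDiffAt (f.open_source.mem_nhds hx)

theorem mdifferentiable : f.MDifferentiable 𝓘(ℝ, E) 𝓘(ℝ, E) :=
  ⟨hf.1.mdifferentiableOn (by simp), hf.2.mdifferentiableOn (by simp)⟩

/-- The differential at a point, as an equivalence of tangent spaces. -/
def tangentEquiv (hx : x ∈ f.source) :
    TangentSpace 𝓘(ℝ, E) x ≃L[ℝ] TangentSpace 𝓘(ℝ, E) (f x) :=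
  hf.mdifferentiable.mfderiv hx

theorem coe_tangentEquiv (hx : x ∈ f.source) :
    (hf.tangentEquiv hx : TangentSpace 𝓘(ℝ, E) x →L[ℝ] TangentSpace 𝓘(ℝ, E) (f x)) =
      mfderiv 𝓘(ℝ, E) 𝓘(ℝ, E) f x := rfl

theorem tangentEquiv_apply (hx : x ∈ f.source) (v : TangentSpace 𝓘(ℝ, E) x) :
    hf.tangentEquiv hx v = mfderiv 𝓘(ℝ, E) 𝓘(ℝ, E) f x v := rfl

theorem isInvertible_mfderiv (hx : x ∈ f.source) :
    (mfderiv 𝓘(ℝ, E) 𝓘(ℝ, E) f x).IsInvertible := ⟨hf.tangentEquiv hx, rfl⟩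

theorem mpullback_eq (hx : x ∈ f.source) (Y : (y : N) → TangentSpace 𝓘(ℝ, E) y) :
    mpullback 𝓘(ℝ, E) 𝓘(ℝ, E) f Y x = (hf.tangentEquiv hx).symm (Y (f x)) := by
  rw [mpullback_apply, ← hf.coe_tangentEquiv hx, ContinuousLinearMap.inverse_equiv]
  rfl

theorem mfderiv_mpullback (hx : x ∈ f.source) (Y : (y : N) → TangentSpace 𝓘(ℝ, E) y) :
    mfderiv 𝓘(ℝ, E) 𝓘(ℝ, E) f x (mpullback 𝓘(ℝ, E) 𝓘(ℝ, E) f Y x) = Y (f x) := by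
  rw [hf.mpullback_eq hx, ← hf.tangentEquiv_apply hx, ContinuousLinearEquiv.apply_symm_apply]

theorem mpullback_symm_apply (hx : x ∈ f.source) (X : (y : M) → TangentSpace 𝓘(ℝ, E) y) :
    mpullback 𝓘(ℝ, E) 𝓘(ℝ, E) f.symm X (f x) = mfderiv 𝓘(ℝ, E) 𝓘(ℝ, E) f x (X x) := by
  rw [hf.symm.mpullback_eq (f.map_source hx), ContinuousLinearEquiv.symm_apply_eq]
  -- The points `f.symm (f x)` and `x` are equal but not by definition; the tangent vectors are
  -- compared because every tangent space is the model space.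
  have h1 : ∀ z, z = x → X z = (show TangentSpace 𝓘(ℝ, E) z from X x) := by
    rintro _ rfl; rfl
  exact (h1 _ (f.left_inv hx)).trans ((hf.tangentEquiv hx).symm_apply_apply (X x)).symm

variable [IsManifold 𝓘(ℝ, E) ∞ M] [IsManifold 𝓘(ℝ, E) ∞ N] [CompleteSpace E]

theorem mdifferentiableAt_mpullback (hx : x ∈ f.source) {Y : (y : N) → TangentSpace 𝓘(ℝ, E) y}
    (hY : MDiffAt (T% Y) (f x)) : MDiffAt (T% (mpullback 𝓘(ℝ, E) 𝓘(ℝ, E) f Y)) x :=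
  hY.mpullback_vectorField (hf.contMDiffAt hx) (hf.isInvertible_mfderiv hx) ENat.LEInfty.out

theorem contMDiffAt_mpullback (hx : x ∈ f.source) {Y : (y : N) → TangentSpace 𝓘(ℝ, E) y}
    (hY : CMDiffAt ∞ (T% Y) (f x)) : CMDiffAt ∞ (T% (mpullback 𝓘(ℝ, E) 𝓘(ℝ, E) f Y)) x :=
  ContMDiffAt.mpullback_vectorField_preimage hY (hf.contMDiffAt hx)
    (hf.isInvertible_mfderiv hx) (by simp)

theorem mdifferentiableAt_mpullback_symm (hx : x ∈ f.source)
    {X : (y : M) → TangentSpace 𝓘(ℝ, E) y} (hX : MDiffAt (T% X) x) :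
    MDiffAt (T% (mpullback 𝓘(ℝ, E) 𝓘(ℝ, E) f.symm X)) (f x) :=
  hf.symm.mdifferentiableAt_mpullback (f.map_source hx) (by rwa [f.left_inv hx])

theorem contMDiffAt_mpullback_symm (hx : x ∈ f.source)
    {X : (y : M) → TangentSpace 𝓘(ℝ, E) y} (hX : CMDiffAt ∞ (T% X) x) :
    CMDiffAt ∞ (T% (mpullback 𝓘(ℝ, E) 𝓘(ℝ, E) f.symm X)) (f x) :=
  hf.symm.contMDiffAt_mpullback (f.map_source hx) (by rwa [f.left_inv hx])

theorem mlieBracket_mpullback (hx : x ∈ f.source) {Y Z : (y : N) → TangentSpace 𝓘(ℝ, E) y}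
    (hY : MDiffAt (T% Y) (f x)) (hZ : MDiffAt (T% Z) (f x)) :
    mfderiv 𝓘(ℝ, E) 𝓘(ℝ, E) f x (mlieBracket 𝓘(ℝ, E) (mpullback 𝓘(ℝ, E) 𝓘(ℝ, E) f Y)
      (mpullback 𝓘(ℝ, E) 𝓘(ℝ, E) f Z) x) = mlieBracket 𝓘(ℝ, E) Y Z (f x) := by
  have : IsManifold 𝓘(ℝ, E) (minSmoothness ℝ 2) M := by
    rw [minSmoothness_of_isRCLikeNormedField]; infer_instance
  have : IsManifold 𝓘(ℝ, E) (minSmoothness ℝ 2) N := by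
    rw [minSmoothness_of_isRCLikeNormedField]; infer_instance
  rw [← mpullback_mlieBracket hY hZ (hf.contMDiffAt hx)
    (by rw [minSmoothness_of_isRCLikeNormedField]; exact ENat.LEInfty.out), hf.mfderiv_mpullback hx]

end IsDiffeo

end Transport

/-! ### Frame fields in a chart -/

section Coordinates

variable {ι : Type*} [Fintype ι]
  {E : Type*} [NormedAddCommGroup E] [NormedSpace ℝ E]
  {M : Type*} [TopologicalSpace M] [ChartedSpace E M]

theorem isDiffeo_of_mem_maximalAtlas {e : OpenPartialHomeomorph M E}
    (he : e ∈ IsManifold.maximalAtlas 𝓘(ℝ, E) ∞ M) : IsDiffeo (E := E) e :=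
  ⟨contMDiffOn_of_mem_maximalAtlas he, contMDiffOn_symm_of_mem_maximalAtlas he⟩

variable {e : OpenPartialHomeomorph M E} {x : M} (he : IsDiffeo (E := E) e)

omit [Fintype ι] in
theorem frameCoord_apply (u : (y : M) → Frame E ι y) (hx : x ∈ e.source) (j : ι) :
    frameCoord e u (e x) j = mfderiv 𝓘(ℝ, E) 𝓘(ℝ, E) e x (u x j) := by
  have h : ∀ z, z = x → mfderiv 𝓘(ℝ, E) 𝓘(ℝ, E) e z (u z j) =
    mfderiv 𝓘(ℝ, E) 𝓘(ℝ, E) e x (u x j) := by rintro _ rfl; rfl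
  exact h _ (e.left_inv hx)

include he

/-- The coordinate expression of a frame, as a basis of the model space. -/
def coordBasis (u : (y : M) → Frame E ι y) (hx : x ∈ e.source) : Module.Basis ι ℝ E :=
  (u x).map (he.tangentEquiv hx).toLinearEquiv

omit [Fintype ι] in
theorem coe_coordBasis (u : (y : M) → Frame E ι y) (hx : x ∈ e.source) :
    coordBasis he u hx = frameCoord e u (e x) := by
  ext j
  rw [frameCoord_apply u hx]
  rfl

theorem frameCoeff_frameCoord (u : (y : M) → Frame E ι y) (hx : x ∈ e.source)
    (w : TangentSpace 𝓘(ℝ, E) x) :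
    frameCoeff (frameCoord e u (e x)) (mfderiv 𝓘(ℝ, E) 𝓘(ℝ, E) e x w) = (u x).repr w := by
  rw [← coe_coordBasis he u hx]
  refine (frameCoeff_basis (coordBasis he u hx) _).trans ?_
  have h := (he.tangentEquiv hx).symm_apply_apply w
  exact congrArg (fun z => ⇑((u x).repr z)) h

-- Identifies the coordinate frame with a pullback by `e.symm`, so that smoothness and brackets of
-- pullbacks apply to it.
omit [Fintype ι] in
theorem frameCoord_eq_mpullback (u : (y : M) → Frame E ι y) {ξ : E} (hξ : ξ ∈ e.target) (j : ι) :
    frameCoord e u ξ j = mpullback 𝓘(ℝ, E) 𝓘(ℝ, E) e.symm (fun y => u y j) ξ := by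
  obtain ⟨y, hy, rfl⟩ : ∃ y ∈ e.source, e y = ξ := ⟨_, e.map_target hξ, e.right_inv hξ⟩
  rw [he.mpullback_symm_apply hy, frameCoord_apply u hy]

variable [IsManifold 𝓘(ℝ, E) ∞ M] [CompleteSpace E]

theorem contDiffAt_frameCoord {u : (y : M) → Frame E ι y} (hx : x ∈ e.source)
    (hu : ∀ j, CMDiffAt ∞ (T% fun y => u y j) x) : ContDiffAt ℝ ∞ (frameCoord e u) (e x) := by
  refine contDiffAt_pi.2 fun j => ?_
  have h := contMDiffAt_vectorSpace_iff_contDiffAt.1 (he.contMDiffAt_mpullback_symm hx (hu j))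
  refine h.congr_of_eventuallyEq ?_
  filter_upwards [e.open_target.mem_nhds (e.map_source hx)] with ξ hξ
  exact frameCoord_eq_mpullback he u hξ j

/-- In the chart the coefficients are `frameCoeff` of the coordinate frame applied to the coordinate
expression of `X`, and both factors are differentiable. -/
theorem mdifferentiableAt_repr_of_mem_source {u : (y : M) → Frame E ι y} (hx : x ∈ e.source)
    (hu : ∀ j, CMDiffAt ∞ (T% fun y => u y j) x) {X : (y : M) → TangentSpace 𝓘(ℝ, E) y}
    (hX : MDiffAt (T% X) x) (j : ι) : MDiffAt (fun y => (u y).repr (X y) j) x := by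
  have h1 : DifferentiableAt ℝ (mpullback 𝓘(ℝ, E) 𝓘(ℝ, E) e.symm X : E → E) (e x) :=
    MDifferentiableAt.differentiableAt <|
      ((contMDiff_snd_tangentBundle_modelSpace E 𝓘(ℝ, E) (n := 1)).contMDiffAt.mdifferentiableAt
        one_ne_zero).comp _ (he.mdifferentiableAt_mpullback_symm hx hX)
  have h2 : DifferentiableAt ℝ (frameCoord e u) (e x) :=
    (contDiffAt_frameCoord he hx hu).differentiableAt (by simp)
  have h3 : DifferentiableAt ℝ (frameCoeff : (ι → E) → _) (frameCoord e u (e x)) := by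
    rw [← coe_coordBasis he u hx]
    exact (contDiffAt_frameCoeff _).differentiableAt (by simp)
  have h4 : DifferentiableAt ℝ (fun ξ => frameCoeff (frameCoord e u ξ)
      (mpullback 𝓘(ℝ, E) 𝓘(ℝ, E) e.symm X ξ : E)) (e x) := (h3.comp (e x) h2).clm_apply h1
  have h5 := differentiableAt_pi.1 h4 j
  refine (h5.mdifferentiableAt.comp x
    ((he.contMDiffAt hx).mdifferentiableAt (by simp))).congr_of_eventuallyEq ?_
  filter_upwards [e.open_source.mem_nhds hx] with y hy
  rw [Function.comp_apply, he.mpullback_symm_apply hy X, frameCoeff_frameCoord he u hy]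

omit he in
/-- The coefficients of a differentiable vector field in a smooth frame are differentiable. -/
theorem mdifferentiableAt_repr {u : (y : M) → Frame E ι y}
    (hu : ∀ j, CMDiffAt ∞ (T% fun y => u y j) x) {X : (y : M) → TangentSpace 𝓘(ℝ, E) y}
    (hX : MDiffAt (T% X) x) (j : ι) : MDiffAt (fun y => (u y).repr (X y) j) x :=
  mdifferentiableAt_repr_of_mem_source
    (isDiffeo_of_mem_maximalAtlas (IsManifold.chart_mem_maximalAtlas x)) (mem_chart_source E x)
      hu hX j

end Coordinates

/-! ### Connections at a point -/

section Connections

variable {ι : Type*} [Fintype ι]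
  {E : Type*} [NormedAddCommGroup E] [NormedSpace ℝ E]
  {M : Type*} [TopologicalSpace M] [ChartedSpace E M] [IsManifold 𝓘(ℝ, E) ∞ M] {x : M}

namespace ConnAt

variable (D : ConnAt E x)

theorem congr_of_eventuallyEq {X Y : (y : M) → TangentSpace 𝓘(ℝ, E) y} (h : X =ᶠ[𝓝 x] Y) :
    D.toFun X = D.toFun Y := by
  classical
  have hT : T% X =ᶠ[𝓝 x] T% Y := h.mono fun y hy => by simp [hy]
  by_cases hX : MDiffAt (T% X) x
  · have hY : MDiffAt (T% Y) x := hX.congr_of_eventuallyEq hT.symm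
    -- No bump function is needed: `f • X = f • Y` everywhere, while `f` is `1` near `x` and so has
    -- zero differential there. The Leibniz rule then identifies both derivatives with that of the
    -- product.
    let f : M → ℝ := fun y => if X y = Y y then 1 else 0
    have hf : f =ᶠ[𝓝 x] fun _ => 1 := h.mono fun y hy => by simp [f, hy]
    have hfd : MDiffAt f x := mdifferentiableAt_const.congr_of_eventuallyEq hf
    have hdf : d% f x = 0 := by
      have : mfderiv 𝓘(ℝ, E) 𝓘(ℝ, ℝ) f x = 0 := by rw [hf.mfderiv_eq, mfderiv_const]; rfl
      exact this
    have hfx : f x = 1 := hf.self_of_nhds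
    have h1 := D.leibniz hX hfd
    have h2 := D.leibniz hY hfd
    have h3 : (fun y => f y • X y) = fun y => f y • Y y := by
      funext y
      by_cases hy : X y = Y y <;> simp [f, hy]
    rw [h3, h2] at h1
    simpa [hdf, hfx] using h1.symm
  · have hY : ¬ MDiffAt (T% Y) x := fun hY => hX (hY.congr_of_eventuallyEq hT)
    rw [D.junk hX, D.junk hY]

theorem map_zero : D.toFun (fun _ => 0) = 0 := by
  have h0 : MDiffAt (T% (0 : (y : M) → TangentSpace 𝓘(ℝ, E) y)) x :=
    Bundle.mdifferentiable_zeroSection ..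
  have h := D.add h0 h0
  rw [add_zero] at h
  exact left_eq_add.1 h

theorem map_sum {κ : Type*} (s : Finset κ) {X : κ → (y : M) → TangentSpace 𝓘(ℝ, E) y}
    (hX : ∀ i ∈ s, MDiffAt (T% (X i)) x) :
    D.toFun (fun y => ∑ i ∈ s, X i y) = ∑ i ∈ s, D.toFun (X i) := by
  classical
  induction s using Finset.induction_on with
  | empty => simpa using D.map_zero
  | insert a s ha h =>
      simp only [Finset.mem_insert, forall_eq_or_imp] at hX
      simp only [Finset.sum_insert ha, ← h hX.2]
      exact D.add hX.1 (.sum_section hX.2)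

theorem map_sum_smul {f : ι → M → ℝ} {X : ι → (y : M) → TangentSpace 𝓘(ℝ, E) y}
    (hf : ∀ i, MDiffAt (f i) x) (hX : ∀ i, MDiffAt (T% (X i)) x) :
    D.toFun (fun y => ∑ i, f i y • X i y) =
      ∑ i, (f i x • D.toFun (X i) + (d% (f i) x).smulRight (X i x)) := by
  rw [D.map_sum (X := fun i y => f i y • X i y) _ fun i _ => (hf i).smul_section (hX i)]
  exact Finset.sum_congr rfl fun i _ => D.leibniz (hX i) (hf i)

variable [CompleteSpace E] {u : (y : M) → Frame E ι y}
  (hu : ∀ j, CMDiffAt ∞ (T% fun y => u y j) x)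
include hu

omit [CompleteSpace E] [Fintype ι] in
theorem mdifferentiableAt_frame (j : ι) : MDiffAt (T% fun y => u y j) x :=
  (hu j).mdifferentiableAt (by simp)

/-- The covariant derivative of a vector field given by its coefficients in a frame. -/
theorem apply_eq_sum_frame {X : (y : M) → TangentSpace 𝓘(ℝ, E) y} (hX : MDiffAt (T% X) x) :
    D.toFun X = ∑ j, ((u x).repr (X x) j • D.toFun (fun y => u y j) +
      (d% (fun y => (u y).repr (X y) j) x).smulRight (u x j)) := by
  rw [← D.map_sum_smul (mdifferentiableAt_repr hu hX) (mdifferentiableAt_frame hu)]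
  congr 1
  funext y
  exact ((u y).sum_repr (X y)).symm

/-- A connection is determined by the covariant derivatives of a frame. -/
theorem ext_frame {D D' : ConnAt E x}
    (h : ∀ j, D.toFun (fun y => u y j) = D'.toFun (fun y => u y j)) : D = D' := by
  ext1
  funext X
  by_cases hX : MDiffAt (T% X) x
  · rw [D.apply_eq_sum_frame hu hX, D'.apply_eq_sum_frame hu hX]
    simp only [h]
  · rw [D.junk hX, D'.junk hX]

open Classical in
/-- The connection at `x` with prescribed covariant derivatives of a frame. -/
def ofFrame (A : ι → TangentSpace 𝓘(ℝ, E) x →L[ℝ] TangentSpace 𝓘(ℝ, E) x) : ConnAt E x where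
  toFun X := if MDiffAt (T% X) x then ∑ j, ((u x).repr (X x) j • A j +
      (d% (fun y => (u y).repr (X y) j) x).smulRight (u x j)) else 0
  add {X Y} hX hY := by
    have hXY : MDiffAt (T% (X + Y)) x := mdifferentiableAt_add_section hX hY
    rw [if_pos hX, if_pos hY, if_pos hXY, ← Finset.sum_add_distrib]
    refine Finset.sum_congr rfl fun j _ => ?_
    have h : (fun y => (u y).repr ((X + Y) y) j) =
        (fun y => (u y).repr (X y) j) + fun y => (u y).repr (Y y) j := by
      funext y; simp
    rw [h, mvfderiv_add (mdifferentiableAt_repr hu hX j) (mdifferentiableAt_repr hu hY j)]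
    ext v
    simp [add_smul]
    module
  leibniz {X f} hX hf := by
    have hfX : MDiffAt (T% fun y => f y • X y) x := hf.smul_section hX
    rw [if_pos hX, if_pos hfX, Finset.smul_sum]
    have h : ∀ j, (fun y => (u y).repr (f y • X y) j) = f • fun y => (u y).repr (X y) j := by
      intro j; funext y; simp
    simp only [h]
    ext v
    -- Expanding `X x` in the frame lets the Leibniz rule be checked term by term.
    have h2 : (d% f x v) • X x = ∑ j, (d% f x v) • (u x).repr (X x) j • u x j := by
      rw [← Finset.smul_sum, (u x).sum_repr]
    simp only [add_apply, ContinuousLinearMap.smulRight_apply, h2,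
      sum_apply, ← Finset.sum_add_distrib]
    refine Finset.sum_congr rfl fun j _ => ?_
    rw [mvfderiv_smul hf (mdifferentiableAt_repr hu hX j)]
    simp
    module
  junk hX := if_neg hX

theorem ofFrame_frame (A : ι → TangentSpace 𝓘(ℝ, E) x →L[ℝ] TangentSpace 𝓘(ℝ, E) x) (k : ι) :
    (ofFrame hu A).toFun (fun y => u y k) = A k := by
  classical
  simp only [ofFrame]
  rw [if_pos (mdifferentiableAt_frame hu k)]
  simp [Finsupp.single_apply, ite_smul, mvfderiv_const]

end ConnAt

end Connections

/-! ### The connection form in a frame field -/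

section ConnectionForm

variable {ι : Type*} [Fintype ι]
  {E : Type*} [NormedAddCommGroup E] [NormedSpace ℝ E]
  {M : Type*} [TopologicalSpace M] [ChartedSpace E M] [IsManifold 𝓘(ℝ, E) ∞ M] {x : M}

/-- The value on `v` of the connection form of `D` in the frame field `u`:
`∇_v u_l = ∑ m, ω(v) m l • u_m`. -/
def ConnAt.connForm (D : ConnAt E x) (u : (y : M) → Frame E ι y) (v : TangentSpace 𝓘(ℝ, E) x) :
    Matrix ι ι ℝ :=
  Matrix.of fun m l => (u x).repr (D.toFun (fun y => u y l) v) m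

namespace ConnAt

variable (D : ConnAt E x) (u : (y : M) → Frame E ι y)

theorem apply_frame (l : ι) (v : TangentSpace 𝓘(ℝ, E) x) :
    D.toFun (fun y => u y l) v = ∑ m, D.connForm u v m l • u x m :=
  ((u x).sum_repr _).symm

theorem connForm_eq_sum (v : TangentSpace 𝓘(ℝ, E) x) :
    D.connForm u v = ∑ k, (u x).repr v k • D.connForm u (u x k) := by
  ext m l
  have h : D.toFun (fun y => u y l) v =
      ∑ k, (u x).repr v k • D.toFun (fun y => u y l) (u x k) := by
    conv_lhs => rw [← (u x).sum_repr v]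
    simp only [_root_.map_sum, map_smul]
  simp [connForm, Matrix.sum_apply, h]

variable {u} [CompleteSpace E] (hu : ∀ j, CMDiffAt ∞ (T% fun y => u y j) x)
include hu

/-- The coefficients of a covariant derivative in a frame. -/
theorem repr_apply {X : (y : M) → TangentSpace 𝓘(ℝ, E) y} (hX : MDiffAt (T% X) x)
    (v : TangentSpace 𝓘(ℝ, E) x) :
    ⇑((u x).repr (D.toFun X v)) = D.connForm u v *ᵥ ⇑((u x).repr (X x)) +
      fun m => d% (fun y => (u y).repr (X y) m) x v := by
  classical
  ext m
  rw [D.apply_eq_sum_frame hu hX]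
  simp [Matrix.mulVec, dotProduct, connForm, Finset.sum_add_distrib, Finsupp.single_apply, mul_comm]

theorem ext_connForm {D D' : ConnAt E x}
    (h : ∀ k, D.connForm u (u x k) = D'.connForm u (u x k)) : D = D' := by
  refine ext_frame hu fun j => ContinuousLinearMap.ext fun v => ?_
  rw [apply_frame, apply_frame, connForm_eq_sum, D'.connForm_eq_sum]
  simp only [h]

/-- With `ext_connForm`, connections at `x` correspond bijectively to arbitrary families of
matrices, one for each frame vector. -/
theorem exists_connForm (a : ι → Matrix ι ι ℝ) :
    ∃ D : ConnAt E x, ∀ k, D.connForm u (u x k) = a k := by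
  -- Finite dimension makes the linear map with prescribed values on the frame continuous.
  have : FiniteDimensional ℝ (TangentSpace 𝓘(ℝ, E) x) := (u x).finiteDimensional_of_finite
  have : T2Space (TangentSpace 𝓘(ℝ, E) x) := inferInstanceAs (T2Space E)
  refine ⟨ofFrame hu fun l => LinearMap.toContinuousLinearMap
    ((u x).constr ℝ fun k => ∑ m, a k m l • u x m), fun k => ?_⟩
  classical
  ext m l
  simp [connForm, ofFrame_frame hu, Finsupp.single_apply]

end ConnAt

/-- `D` commutes at `x` with the field of endomorphisms `A`. -/
def ParallelAt {U : TopologicalSpace.Opens M} {x : U} (D : ConnAt E (x : M)) (A : EndoField E U) :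
    Prop :=
  ∀ X : (y : M) → TangentSpace 𝓘(ℝ, E) y, MDiffAt (T% X) (x : M) →
    ∀ v, D.toFun (A.act X) v = A x (D.toFun X v)

/-- A field of endomorphisms with a constant matrix in a frame is parallel if and only if its matrix
commutes with the connection form. -/
theorem parallelAt_iff [DecidableEq ι] [CompleteSpace E] {U : TopologicalSpace.Opens M} {x : U}
    (D : ConnAt E (x : M)) {A : EndoField E U} {u : (y : M) → Frame E ι y}
    (hu : ∀ j, CMDiffAt ∞ (T% fun y => u y j) (x : M)) {q : Matrix ι ι ℝ}
    (hA : ∀ᶠ y in 𝓝 (x : M), ∀ h : y ∈ U, A ⟨y, h⟩ = Matrix.toLin (u y) (u y) q) :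
    ParallelAt D A ↔ ∀ v, D.connForm u v * q = q * D.connForm u v := by
  have hAx : A x = Matrix.toLin (u x) (u x) q := hA.self_of_nhds x.2
  have hrepr : ∀ (y : M) (w : TangentSpace 𝓘(ℝ, E) y),
      ⇑((u y).repr (Matrix.toLin (u y) (u y) q w)) = q *ᵥ ⇑((u y).repr w) := fun y w =>
    (LinearMap.toMatrix_mulVec_repr (u y) (u y) (Matrix.toLin (u y) (u y) q) w).symm.trans
      (by rw [LinearMap.toMatrix_toLin])
  have hact : ∀ X : (y : M) → TangentSpace 𝓘(ℝ, E) y,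
      A.act X =ᶠ[𝓝 (x : M)] fun y => Matrix.toLin (u y) (u y) q (X y) := by
    intro X
    filter_upwards [hA, U.isOpen.mem_nhds x.2] with y hy hyU
    exact (dif_pos hyU).trans (by rw [hy hyU])
  -- `W l` represents `A u_l` near `x`; as `q` is constant, its covariant derivative has
  -- coefficients `ω q` without a derivative term.
  let W : ι → (y : M) → TangentSpace 𝓘(ℝ, E) y := fun l y => ∑ k, q k l • u y k
  have hW : ∀ l, MDiffAt (T% (W l)) (x : M) := fun l =>
    .sum_section fun k _ => mdifferentiableAt_const.smul_section (ConnAt.mdifferentiableAt_frame hu k)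
  have hWx : ∀ l m, (u x).repr (W l x) m = q m l := fun l m => by
    simp [W, Finsupp.single_apply]
  have hDW : ∀ l v m, (u x).repr (D.toFun (W l) v) m = (D.connForm u v * q) m l := fun l v m => by
    have h := D.map_sum_smul (f := fun k _ => q k l) (X := fun k y => u y k)
      (fun k => mdifferentiableAt_const) (ConnAt.mdifferentiableAt_frame hu)
    rw [h]
    simp [mvfderiv_const, Matrix.mul_apply, ConnAt.connForm, mul_comm]
  have hexp : ∀ X : (y : M) → TangentSpace 𝓘(ℝ, E) y,
      (fun y => Matrix.toLin (u y) (u y) q (X y)) =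
        fun y => ∑ l, (u y).repr (X y) l • W l y := by
    intro X
    funext y
    have h := congrArg (Matrix.toLin (u y) (u y) q) ((u y).sum_repr (X y))
    simp only [map_sum, map_smul, Matrix.toLin_self] at h
    exact h.symm
  -- If `ξ` are the coefficients of `X`, then `∇_v (A X)` has coefficients `ω q ξ + q dξ(v)` and `A
  -- (∇_v X)` has `q ω ξ + q dξ(v)`; the derivative terms cancel.
  have key : ∀ X : (y : M) → TangentSpace 𝓘(ℝ, E) y, MDiffAt (T% X) (x : M) → ∀ v,
      (D.toFun (A.act X) v = A x (D.toFun X v) ↔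
        (D.connForm u v * q) *ᵥ ⇑((u x).repr (X x)) =
          (q * D.connForm u v) *ᵥ ⇑((u x).repr (X x))) := by
    intro X hX v
    rw [D.congr_of_eventuallyEq (hact X), hexp, hAx,
      D.map_sum_smul (mdifferentiableAt_repr hu hX) hW, ← (u x).repr.injective.eq_iff,
      ← DFunLike.coe_injective.eq_iff, hrepr, D.repr_apply hu hX, Matrix.mulVec_add,
      Matrix.mulVec_mulVec]
    have h1 : ⇑((u x).repr ((∑ l, ((u x).repr (X x) l • D.toFun (W l) +
        (d% (fun y => (u y).repr (X y) l) (x : M)).smulRight (W l x))) v)) =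
        (D.connForm u v * q) *ᵥ ⇑((u x).repr (X x)) +
          q *ᵥ fun m => d% (fun y => (u y).repr (X y) m) (x : M) v := by
      ext m
      simp [Finset.sum_add_distrib, hWx, hDW, Matrix.mulVec, dotProduct, mul_comm]
    rw [h1, add_left_inj]
  constructor
  · intro h v
    refine Matrix.ext_of_mulVec_single fun l => ?_
    have h1 := (key (fun y => u y l) (ConnAt.mdifferentiableAt_frame hu l) v).1
      (h _ (ConnAt.mdifferentiableAt_frame hu l) v)
    simpa [Finsupp.single_eq_pi_single] using h1
  · intro h X hX v
    rw [key X hX, h]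

end ConnectionForm

/-! ### Lifts of sections of `FM/G` to frame fields -/

section Lifts

variable {ι : Type*} [Fintype ι] [DecidableEq ι]
  {E : Type*} [NormedAddCommGroup E] [NormedSpace ℝ E]
  {M : Type*} [TopologicalSpace M] [ChartedSpace E M] [IsManifold 𝓘(ℝ, E) ∞ M]
  {G : Subgroup (GL ι ℝ)} {U : TopologicalSpace.Opens M} {s : (x : U) → FrameQuot E G (x : M)}
  {u : (y : M) → Frame E ι y} {x : M}

theorem IsLiftNear.contMDiffAt (h : IsLiftNear s u x) (j : ι) :
    CMDiffAt ∞ (T% fun y => u y j) x := by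
  obtain ⟨V, -, hx, hu, -⟩ := h
  exact (hu j).contMDiffAt (V.isOpen.mem_nhds hx)

theorem IsLiftNear.eventually (h : IsLiftNear s u x) : ∀ᶠ y in 𝓝 x, IsLiftNear s u y := by
  obtain ⟨V, hV, hx, hu, hs⟩ := h
  filter_upwards [V.isOpen.mem_nhds hx] with y hy using ⟨V, hV, hy, hu, hs⟩

theorem IsLiftNear.eq_coset (h : IsLiftNear s u x) (hx : x ∈ U) : s ⟨x, hx⟩ = coset G (u x) := by
  obtain ⟨V, hV, hx, hu, hs⟩ := h
  exact hs ⟨x, hx⟩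

end Lifts

/-! ### The canonical connection at a point -/

section Canonical

variable {n : ℕ} {E : Type*} [NormedAddCommGroup E] [NormedSpace ℝ E]
  {M : Type*} [TopologicalSpace M] [ChartedSpace E M] [IsManifold 𝓘(ℝ, E) ∞ M]
  {U : TopologicalSpace.Opens M}

/-- Commuting with `matF` kills the off-diagonal blocks; commuting with `matP` then equates the
diagonal ones. -/
theorem commute_matF_matP_iff (a : Matrix (Fin n ⊕ Fin n) (Fin n ⊕ Fin n) ℝ) :
    (a * matF n = matF n * a ∧ a * matP n = matP n * a) ↔
      ∃ B : Matrix (Fin n) (Fin n) ℝ, a = Matrix.fromBlocks B 0 0 B := by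
  constructor
  · rintro ⟨hF, hP⟩
    obtain ⟨A, B, C, D, rfl⟩ : ∃ A B C D, a = Matrix.fromBlocks A B C D :=
      ⟨_, _, _, _, (Matrix.fromBlocks_toBlocks a).symm⟩
    simp only [matF, matP, Matrix.fromBlocks_multiply, Matrix.fromBlocks_inj, Matrix.mul_one,
      Matrix.one_mul, Matrix.mul_zero, Matrix.zero_mul, add_zero, zero_add, Matrix.mul_neg,
      Matrix.neg_mul] at hF hP
    have hB : B = 0 := by ext i j; exact self_eq_neg.1 (congrFun₂ hF.2.1 i j).symm
    have hC : C = 0 := by ext i j; exact self_eq_neg.1 (congrFun₂ hF.2.2.1 i j)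
    exact ⟨A, by rw [hB, hC, hP.2.1]⟩
  · rintro ⟨B, rfl⟩
    simp [matF, matP, Matrix.fromBlocks_multiply]

theorem mem_deltaGL_iff (g : GL (Fin n ⊕ Fin n) ℝ) :
    g ∈ deltaGL n ↔ ∃ B : Matrix (Fin n) (Fin n) ℝ,
      (g : Matrix (Fin n ⊕ Fin n) (Fin n ⊕ Fin n) ℝ) = Matrix.fromBlocks B 0 0 B := by
  constructor
  · rintro ⟨A, hA⟩
    exact ⟨A, hA⟩
  · rintro ⟨B, hB⟩
    have hu : IsUnit (Matrix.fromBlocks B 0 0 B) := hB ▸ g.isUnit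
    rw [Matrix.isUnit_fromBlocks_zero₁₂] at hu
    exact ⟨hu.1.unit, hB⟩

/-- No block exponential is computed: the exponential commutes with whatever its argument commutes
with, so it again has the form `diag(B, B)`, and it is invertible. -/
theorem fromBlocks_mem_lieAlgebra (B : Matrix (Fin n) (Fin n) ℝ) :
    Matrix.fromBlocks B 0 0 B ∈ lieAlgebra (deltaGL n) := by
  intro t
  have hc := (commute_matF_matP_iff (t • Matrix.fromBlocks B 0 0 B)).2
    ⟨t • B, by simp [Matrix.fromBlocks_smul]⟩
  have hF : Commute (t • Matrix.fromBlocks B 0 0 B) (matF n) := hc.1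
  have hP : Commute (t • Matrix.fromBlocks B 0 0 B) (matP n) := hc.2
  obtain ⟨g, hg⟩ := Matrix.isUnit_exp (𝔸 := ℝ) (t • Matrix.fromBlocks B 0 0 B)
  exact ⟨g, (mem_deltaGL_iff g).2 (hg ▸ (commute_matF_matP_iff _).1 ⟨hF.exp_left, hP.exp_left⟩), hg⟩

theorem IsLiftNear.eventually_tensorF {s : QuotSection E (deltaGL n) U}
    {u : (y : M) → Frame E (Fin n ⊕ Fin n) y} {x : M} (h : IsLiftNear s.toFun u x) :
    ∀ᶠ y in 𝓝 x, ∀ hy : y ∈ U, tensorF s ⟨y, hy⟩ = Matrix.toLin (u y) (u y) (matF n) := by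
  filter_upwards [h.eventually] with y hy hyU
  rw [tensorF, hy.eq_coset hyU]
  rfl

theorem IsLiftNear.eventually_tensorP {s : QuotSection E (deltaGL n) U}
    {u : (y : M) → Frame E (Fin n ⊕ Fin n) y} {x : M} (h : IsLiftNear s.toFun u x) :
    ∀ᶠ y in 𝓝 x, ∀ hy : y ∈ U, tensorP s ⟨y, hy⟩ = Matrix.toLin (u y) (u y) (matP n) := by
  filter_upwards [h.eventually] with y hy hyU
  rw [tensorP, hy.eq_coset hyU]
  rfl

/-- The torsion `T(X, Y) = ∇_X Y - ∇_Y X - [X, Y]` at `x`. -/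
def ConnAt.torsion {x : M} (D : ConnAt E x) (X Y : (y : M) → TangentSpace 𝓘(ℝ, E) y) :
    TangentSpace 𝓘(ℝ, E) x :=
  D.toFun Y (X x) - D.toFun X (Y x) - mlieBracket 𝓘(ℝ, E) X Y x

/-- The term `(Y f) X` from the Leibniz rule for `∇_Y (f X)` cancels the one in `[f X, Y]`.
Tensoriality reduces the torsion condition to pairs of frame fields. -/
theorem ConnAt.tensorialAt_torsion_left [CompleteSpace E] {x : M} (D : ConnAt E x)
    (Y : (y : M) → TangentSpace 𝓘(ℝ, E) y) :
    TensorialAt 𝓘(ℝ, E) E (fun X => D.torsion X Y) x where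
  smul {f X} hf hX := by
    have h := D.leibniz hX hf
    simp only [torsion, mlieBracket_smul_left hf hX]
    change _ - D.toFun (fun y => f y • X y) _ - _ = _
    rw [h]
    simp
    module
  add {X X'} hX hX' := by
    simp only [torsion, mlieBracket_add_left hX hX', D.add hX hX']
    simp
    module

theorem ConnAt.tensorialAt_torsion_right [CompleteSpace E] {x : M} (D : ConnAt E x)
    (X : (y : M) → TangentSpace 𝓘(ℝ, E) y) :
    TensorialAt 𝓘(ℝ, E) E (fun Y => D.torsion X Y) x where
  smul {f Y} hf hY := by
    have h := D.leibniz hY hf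
    simp only [torsion, mlieBracket_smul_right hf hY]
    change D.toFun (fun y => f y • Y y) _ - _ - _ = _
    rw [h]
    simp
    module
  add {Y Y'} hY hY' := by
    simp only [torsion, mlieBracket_add_right hY hY', D.add hY hY']
    simp
    module

theorem tensorialAt_eq_sum_frame {ι : Type*} [Fintype ι] [CompleteSpace E] {x : M}
    {A : Type*} [AddCommGroup A] [Module ℝ A] {Φ : ((y : M) → TangentSpace 𝓘(ℝ, E) y) → A}
    (hΦ : TensorialAt 𝓘(ℝ, E) E Φ x) {u : (y : M) → Frame E ι y}
    (hu : ∀ j, CMDiffAt ∞ (T% fun y => u y j) x) {X : (y : M) → TangentSpace 𝓘(ℝ, E) y}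
    (hX : MDiffAt (T% X) x) : Φ X = ∑ j, (u x).repr (X x) j • Φ fun y => u y j := by
  have h : X = fun y => ∑ j, (u y).repr (X y) j • u y j := by
    funext y
    exact ((u y).sum_repr (X y)).symm
  have hd := ConnAt.mdifferentiableAt_frame hu
  conv_lhs => rw [h]
  rw [hΦ.sum (fun j y => (u y).repr (X y) j • u y j) fun j _ =>
    (mdifferentiableAt_repr hu hX j).smul_section (hd j)]
  exact Finset.sum_congr rfl fun j _ => hΦ.smul (mdifferentiableAt_repr hu hX j) (hd j)

/-- `D` is at `x` the canonical connection of `(F, P)`. -/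
def IsCanonicalAt {x : U} (F P : EndoField E U) (D : ConnAt E (x : M)) : Prop :=
  ParallelAt D F ∧ ParallelAt D P ∧
    ∀ X Y : (y : M) → TangentSpace 𝓘(ℝ, E) y,
      MDiffAt (T% X) (x : M) → MDiffAt (T% Y) (x : M) →
      F x (X x) = X x → F x (Y x) = -Y x →
      D.toFun Y (X x) - D.toFun X (Y x) - mlieBracket 𝓘(ℝ, E) X Y (x : M) = 0

theorem isCanonicalConnection_iff {F P : EndoField E U} {D : LinearConnection E U} :
    IsCanonicalConnection F P D ↔ ∀ x, IsCanonicalAt F P (D.toFun x) :=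
  ⟨fun h x => ⟨h.1 x, h.2.1 x, h.2.2 x⟩,
    fun h => ⟨fun x => (h x).1, fun x => (h x).2.1, fun x => (h x).2.2⟩⟩

/-- The structure functions `[u_k, u_l] = ∑ m, c k l m • u_m` of a frame field. -/
def structCoeff {ι : Type*} [Fintype ι] (u : (y : M) → Frame E ι y) (x : M) (k l m : ι) : ℝ :=
  (u x).repr (mlieBracket 𝓘(ℝ, E) (fun y => u y k) (fun y => u y l) x) m

/-- The values on a frame of the connection form of the canonical connection, in terms of the
structure functions of the frame. -/
def canonicalForm (c : Fin n ⊕ Fin n → Fin n ⊕ Fin n → Fin n ⊕ Fin n → ℝ) (k : Fin n ⊕ Fin n) :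
    Matrix (Fin n ⊕ Fin n) (Fin n ⊕ Fin n) ℝ :=
  -- For `k = inl i` the entry is the `Y_m`-component of `[X_i, Y_j]`; for `k = inr i` it is the
  -- `X_m`-component of `[Y_i, X_j]`.
  let B : Matrix (Fin n) (Fin n) ℝ := Matrix.of fun m j =>
    Sum.elim (fun _ => c k (Sum.inr j) (Sum.inr m)) (fun _ => c k (Sum.inl j) (Sum.inl m)) k
  Matrix.fromBlocks B 0 0 B

/-- The heart of the proof: in an adapted frame the conditions become a decoupled linear system that
gives the connection form explicitly. -/
theorem isCanonicalAt_iff [CompleteSpace E] {x : U}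
    {s : QuotSection E (deltaGL n) U} {u : (y : M) → Frame E (Fin n ⊕ Fin n) y}
    (h : IsLiftNear s.toFun u (x : M)) (D : ConnAt E (x : M)) :
    IsCanonicalAt (tensorF s) (tensorP s) D ↔
      ∀ k, D.connForm u (u x k) = canonicalForm (structCoeff u x) k := by
  have hu := h.contMDiffAt
  have hud := ConnAt.mdifferentiableAt_frame hu
  have hFx : tensorF s x = Matrix.toLin (u x) (u x) (matF n) :=
    h.eventually_tensorF.self_of_nhds x.2
  have hFl : ∀ i, tensorF s x (u x (Sum.inl i)) = u x (Sum.inl i) := fun i => by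
    rw [hFx, Matrix.toLin_self]; simp [matF, Matrix.one_apply, ite_smul]
  have hFr : ∀ i, tensorF s x (u x (Sum.inr i)) = - u x (Sum.inr i) := fun i => by
    rw [hFx, Matrix.toLin_self]; simp [matF, Matrix.one_apply, ite_smul]
  have htor : ∀ i j m,
      (u x).repr (D.torsion (fun y => u y (Sum.inl i)) (fun y => u y (Sum.inr j))) m =
      D.connForm u (u x (Sum.inl i)) m (Sum.inr j) - D.connForm u (u x (Sum.inr j)) m (Sum.inl i) -
        structCoeff u x (Sum.inl i) (Sum.inr j) m := fun i j m => by
    simp [ConnAt.torsion, ConnAt.connForm, structCoeff]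
  have hsk : ∀ k l m, structCoeff u x k l m = - structCoeff u x l k m := fun k l m => by
    rw [structCoeff, mlieBracket_swap_apply, map_neg]; rfl
  rw [IsCanonicalAt, parallelAt_iff D hu h.eventually_tensorF,
    parallelAt_iff D hu h.eventually_tensorP, ← and_assoc, ← forall_and]
  simp only [commute_matF_matP_iff]
  constructor
  · rintro ⟨hB, ht⟩ k
    have ht' : ∀ i j m, D.connForm u (u x (Sum.inl i)) m (Sum.inr j) -
        D.connForm u (u x (Sum.inr j)) m (Sum.inl i) -
          structCoeff u x (Sum.inl i) (Sum.inr j) m = 0 := fun i j m => by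
      rw [← htor, ConnAt.torsion, ht _ _ (hud _) (hud _) (hFl i) (hFr j)]
      simp
    choose B hB using hB
    simp only [hB] at ht' ⊢
    rw [canonicalForm]
    suffices hk : B (u x k) = Matrix.of fun m j => Sum.elim
        (fun _ => structCoeff u x k (Sum.inr j) (Sum.inr m))
        (fun _ => structCoeff u x k (Sum.inl j) (Sum.inl m)) k by rw [hk]
    -- In `T(X_i, Y_j) = 0` the `Y`-components involve only `B(X_i)` and the `X`-components only
    -- `B(Y_j)`. The second case swaps the roles of `i` and `j`, hence the use of skew-symmetry.
    ext m j
    rcases k with i | i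
    · simpa [sub_eq_zero] using ht' i j (Sum.inr m)
    · have h1 := ht' j i (Sum.inl m)
      rw [hsk] at h1
      simp at h1 ⊢
      linarith
  · intro hk
    refine ⟨fun v => ?_, fun X Y hX hY hFX hFY => ?_⟩
    -- The matrices `diag(B, B)` are closed under linear combinations, so it is enough that the form
    -- has this shape on the frame vectors.
    · rw [ConnAt.connForm_eq_sum]
      simp only [hk, canonicalForm, Matrix.fromBlocks_smul, smul_zero]
      generalize (u x).repr v = c
      clear hk
      classical
      induction (Finset.univ : Finset (Fin n ⊕ Fin n)) using Finset.induction_on with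
      | empty => exact ⟨0, by simp⟩
      | insert a t ha ih =>
        obtain ⟨B, hB⟩ := ih
        rw [Finset.sum_insert ha, hB, Matrix.fromBlocks_add]
        simp only [add_zero]
        exact ⟨_, rfl⟩
    · have ht : ∀ i j, D.torsion (fun y => u y (Sum.inl i)) (fun y => u y (Sum.inr j)) = 0 := by
        intro i j
        rw [← (u x).repr.map_eq_zero_iff]
        ext m
        rw [htor, hk, hk]
        rcases m with m | m
        · simp [canonicalForm, hsk (Sum.inr j)]
        · simp [canonicalForm]
      -- The eigenvector conditions hold only at `x`, which suffices for a tensorial expression: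
      -- only the pairs `(X_i, Y_j)` survive.
      have hXr : ∀ i, (u x).repr (X x) (Sum.inr i) = 0 := fun i => by
        have h1 := congrFun (LinearMap.toMatrix_mulVec_repr (u x) (u x) (tensorF s x) (X x))
          (Sum.inr i)
        rw [hFX, hFx, LinearMap.toMatrix_toLin] at h1
        simp [matF, Matrix.fromBlocks_mulVec, Matrix.neg_mulVec] at h1
        linarith
      have hYl : ∀ i, (u x).repr (Y x) (Sum.inl i) = 0 := fun i => by
        have h1 := congrFun (LinearMap.toMatrix_mulVec_repr (u x) (u x) (tensorF s x) (Y x))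
          (Sum.inl i)
        rw [hFY, hFx, LinearMap.toMatrix_toLin] at h1
        simp [matF, Matrix.fromBlocks_mulVec] at h1
        linarith
      change D.torsion X Y = 0
      rw [tensorialAt_eq_sum_frame (D.tensorialAt_torsion_left Y) hu hX]
      refine Finset.sum_eq_zero fun k _ => ?_
      rw [tensorialAt_eq_sum_frame (D.tensorialAt_torsion_right _) hu hY]
      rcases k with i | i
      · rw [Fintype.sum_sum_type]
        simp [hYl, ht]
      · rw [hXr, zero_smul]

end Canonical

/-! ### Christoffel symbols and structure functions in a chart -/

section Christoffel

variable {ι : Type*} [Fintype ι]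
  {E : Type*} [NormedAddCommGroup E] [NormedSpace ℝ E]
  {M : Type*} [TopologicalSpace M] [ChartedSpace E M] [IsManifold 𝓘(ℝ, E) ∞ M] {x : M}
  {e : OpenPartialHomeomorph M E} (he : IsDiffeo (E := E) e) (hx : x ∈ e.source)

theorem mdifferentiableAt_of_contDiffAt {V : (ξ : E) → TangentSpace 𝓘(ℝ, E) ξ} {ξ : E}
    (h : ContDiffAt ℝ ∞ (F := E) V ξ) : MDiffAt (T% V) ξ :=
  (contMDiffAt_vectorSpace_iff_contDiffAt.2 h).mdifferentiableAt (by simp)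

/-- A constant vector field on a normed space. -/
def constField (w : E) (ξ : E) : TangentSpace 𝓘(ℝ, E) ξ := w

/-- The coordinate expression of a member of a frame field, as a vector field. -/
def frameCoordField (e : OpenPartialHomeomorph M E) (u : (y : M) → Frame E ι y) (l : ι) (ξ : E) :
    TangentSpace 𝓘(ℝ, E) ξ :=
  (frameCoord e u ξ l : E)

theorem apply_eq_sum_basis {F : Type*} [NormedAddCommGroup F] [NormedSpace ℝ F]
    (b : Module.Basis ι ℝ E) (L : E →L[ℝ] F) (w : E) : L w = ∑ l, b.repr w l • L (b l) := by
  conv_lhs => rw [← b.sum_repr w]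
  simp only [map_sum, map_smul]

-- Holds at every point, since `mpullback` is linear in the value of the field even where the
-- differential is not invertible.
omit [IsManifold 𝓘(ℝ, E) ∞ M] in
theorem mpullback_eq_sum (b : Module.Basis ι ℝ E) (e : M → E)
    (V : (ξ : E) → TangentSpace 𝓘(ℝ, E) ξ) (y : M) :
    mpullback 𝓘(ℝ, E) 𝓘(ℝ, E) e V y =
      ∑ l, b.repr (V (e y)) l • mpullback 𝓘(ℝ, E) 𝓘(ℝ, E) e (constField (b l)) y :=
  apply_eq_sum_basis b (show E →L[ℝ] E from (mfderiv 𝓘(ℝ, E) 𝓘(ℝ, E) e y).inverse) (V (e y))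

include he hx

omit [IsManifold 𝓘(ℝ, E) ∞ M] [Fintype ι] in
theorem frame_eventuallyEq_mpullback (u : (y : M) → Frame E ι y) (l : ι) :
    (fun y => u y l) =ᶠ[𝓝 x] mpullback 𝓘(ℝ, E) 𝓘(ℝ, E) e (frameCoordField e u l) := by
  filter_upwards [e.open_source.mem_nhds hx] with y hy
  have h : u y l = mpullback 𝓘(ℝ, E) 𝓘(ℝ, E) e (frameCoordField e u l) y := by
    rw [he.mpullback_eq hy, ContinuousLinearEquiv.eq_symm_apply]
    exact (frameCoord_apply u hy l).symm
  exact h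

theorem mdifferentiableAt_mpullback_const [CompleteSpace E] (w : E) :
    MDiffAt (T% (mpullback 𝓘(ℝ, E) 𝓘(ℝ, E) e (constField w))) x :=
  he.mdifferentiableAt_mpullback hx
    (mdifferentiableAt_of_contDiffAt (V := constField w)
      (contDiffAt_const : ContDiffAt ℝ ∞ (fun _ : E => w) (e x)))

/-- The differential of a chart, as an equivalence with the model space. -/
def chartEquiv : TangentSpace 𝓘(ℝ, E) x ≃L[ℝ] E := he.tangentEquiv hx

omit [IsManifold 𝓘(ℝ, E) ∞ M] in
theorem chartEquiv_apply (v : TangentSpace 𝓘(ℝ, E) x) :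
    chartEquiv he hx v = mfderiv 𝓘(ℝ, E) 𝓘(ℝ, E) e x v := rfl

omit [IsManifold 𝓘(ℝ, E) ∞ M] in
theorem chartEquiv_mpullback (V : (ξ : E) → TangentSpace 𝓘(ℝ, E) ξ) :
    chartEquiv he hx (mpullback 𝓘(ℝ, E) 𝓘(ℝ, E) e V x) = V (e x) :=
  he.mfderiv_mpullback hx V

omit [IsManifold 𝓘(ℝ, E) ∞ M] [Fintype ι] in
theorem chartEquiv_frame (u : (y : M) → Frame E ι y) (l : ι) :
    chartEquiv he hx (u x l) = frameCoord e u (e x) l :=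
  (frameCoord_apply u hx l).symm

theorem christoffel_eq (D : ConnAt E x) (v w : E) :
    D.christoffel e v w = chartEquiv he hx (D.toFun (mpullback 𝓘(ℝ, E) 𝓘(ℝ, E) e (constField w))
      ((chartEquiv he hx).symm v)) := by
  change mfderiv 𝓘(ℝ, E) 𝓘(ℝ, E) e x (D.toFun (mpullback 𝓘(ℝ, E) 𝓘(ℝ, E) e (constField w))
    (mpullback 𝓘(ℝ, E) 𝓘(ℝ, E) e (constField v) x)) = _
  rw [he.mpullback_eq hx]
  rfl

/-- Covariant derivatives of a frame field in coordinates. -/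
theorem christoffel_frameCoord [CompleteSpace E] (D : ConnAt E x) {u : (y : M) → Frame E ι y}
    (hu : ∀ j, CMDiffAt ∞ (T% fun y => u y j) x) (v : E) (l : ι) :
    D.christoffel e v (frameCoord e u (e x) l) =
      chartEquiv he hx (D.toFun (fun y => u y l) ((chartEquiv he hx).symm v)) -
        fderiv ℝ (frameCoord e u) (e x) v l := by
  classical
  -- The coordinate frame is frozen at `x` to a constant basis `b`, and `u_l` is written as `∑ f_m
  -- ∂_{b_m}` nearby. Since `f_m` is `1` or `0` at `x` according as `m = l` or not, the Leibniz rule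
  -- leaves `Γ(v, b_l)` plus the derivative of the coordinate frame.
  set b := coordBasis he u hx
  have hbc : ∀ m, b m = frameCoord e u (e x) m := fun m => by rw [← coe_coordBasis he u hx]
  have : FiniteDimensional ℝ E := b.finiteDimensional_of_finite
  have hA := (contDiffAt_frameCoord he hx hu).differentiableAt (by simp)
  have hAl : DifferentiableAt ℝ (fun ξ => frameCoord e u ξ l) (e x) := differentiableAt_pi.1 hA l
  let c : ι → E →L[ℝ] ℝ := fun m => LinearMap.toContinuousLinearMap (b.coord m)
  let f : ι → M → ℝ := fun m y => c m (frameCoord e u (e y) l)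
  have hed : MDiffAt e x := (he.contMDiffAt hx).mdifferentiableAt (by simp)
  have hcl : ∀ m, DifferentiableAt ℝ (fun ξ => c m (frameCoord e u ξ l)) (e x) := fun m =>
    (c m).differentiableAt.comp _ hAl
  have hf : ∀ m, MDiffAt (f m) x := fun m => (hcl m).mdifferentiableAt.comp x hed
  have hdf : ∀ m v', d% (f m) x v' =
      c m (fderiv ℝ (frameCoord e u) (e x) (mfderiv 𝓘(ℝ, E) 𝓘(ℝ, E) e x v') l) := by
    intro m v'
    have h1 : mfderiv 𝓘(ℝ, E) 𝓘(ℝ, ℝ) (f m) x = (mfderiv 𝓘(ℝ, E) 𝓘(ℝ, ℝ)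
        (fun ξ => c m (frameCoord e u ξ l)) (e x)).comp (mfderiv 𝓘(ℝ, E) 𝓘(ℝ, E) e x) :=
      mfderiv_comp x (hcl m).mdifferentiableAt hed
    have h2 : fderiv ℝ (fun ξ => c m (frameCoord e u ξ l)) (e x) =
        (c m).comp ((ContinuousLinearMap.proj l).comp (fderiv ℝ (frameCoord e u) (e x))) :=
      (((c m).hasFDerivAt.comp (e x) (hasFDerivAt_pi'.1 hA.hasFDerivAt l))).fderiv
    rw [mfderiv_eq_fderiv, h2] at h1
    exact DFunLike.congr_fun h1 v'
  have hexp : ∀ᶠ y in 𝓝 x,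
      u y l = ∑ m, f m y • mpullback 𝓘(ℝ, E) 𝓘(ℝ, E) e (constField (b m)) y := by
    filter_upwards [frame_eventuallyEq_mpullback he hx u l] with y hy
    exact hy.trans (mpullback_eq_sum b e _ y)
  have hfx : ∀ m, f m x = if l = m then 1 else 0 := fun m => by
    simp [f, c, ← hbc, Finsupp.single_apply]
  have hD := D.map_sum_smul hf fun m => mdifferentiableAt_mpullback_const he hx (b m)
  rw [(D.congr_of_eventuallyEq hexp).trans hD, christoffel_eq he hx, ← hbc]
  have hsum : ∑ m, c m (fderiv ℝ (frameCoord e u) (e x) v l) • b m =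
    fderiv ℝ (frameCoord e u) (e x) v l := b.sum_repr _
  have hv : mfderiv 𝓘(ℝ, E) 𝓘(ℝ, E) e x ((chartEquiv he hx).symm v) = v :=
    (chartEquiv he hx).apply_symm_apply v
  rw [eq_sub_iff_add_eq]
  simp only [sum_apply, add_apply, ContinuousLinearMap.smulRight_apply, hdf,
    smul_apply, hfx, hv, map_sum, map_add, map_smul, chartEquiv_mpullback,
    Finset.sum_add_distrib]
  simp
  exact hsum.symm

theorem christoffel_eq_sum [CompleteSpace E] (D : ConnAt E x) (b : Module.Basis ι ℝ E) (v w : E) :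
    D.christoffel e v w = ∑ l, b.repr w l • D.christoffel e v (b l) := by
  have h : mpullback 𝓘(ℝ, E) 𝓘(ℝ, E) e (constField w) =
      fun y : M => ∑ l, b.repr w l • mpullback 𝓘(ℝ, E) 𝓘(ℝ, E) e (constField (b l)) y := by
    funext y
    exact mpullback_eq_sum b e _ y
  simp only [christoffel_eq he hx]
  rw [h, D.map_sum_smul (f := fun l _ => b.repr w l) (fun l => mdifferentiableAt_const)
    fun l => mdifferentiableAt_mpullback_const he hx (b l)]
  simp [mvfderiv_const]

/-- The structure functions of a frame field in coordinates. -/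
theorem structCoeff_eq [CompleteSpace E] {u : (y : M) → Frame E ι y}
    (hu : ∀ j, CMDiffAt ∞ (T% fun y => u y j) x) (k l m : ι) :
    structCoeff u x k l m = frameCoeff (frameCoord e u (e x))
      (fderiv ℝ (frameCoord e u) (e x) (frameCoord e u (e x) k) l -
        fderiv ℝ (frameCoord e u) (e x) (frameCoord e u (e x) l) k) m := by
  have hA := contDiffAt_frameCoord he hx hu
  have hV : ∀ j, MDiffAt (T% (frameCoordField e u j)) (e x) := fun j =>
    mdifferentiableAt_of_contDiffAt (V := frameCoordField e u j) (contDiffAt_pi.1 hA j)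
  have hd : ∀ j, fderiv ℝ (fun ξ => frameCoord e u ξ j) (e x) =
      (ContinuousLinearMap.proj j).comp (fderiv ℝ (frameCoord e u) (e x)) := fun j =>
    (hasFDerivAt_pi'.1 (hA.differentiableAt (by simp)).hasFDerivAt j).fderiv
  have h1 : mlieBracket 𝓘(ℝ, E) (frameCoordField e u k) (frameCoordField e u l) (e x) =
      fderiv ℝ (frameCoord e u) (e x) (frameCoord e u (e x) k) l -
        fderiv ℝ (frameCoord e u) (e x) (frameCoord e u (e x) l) k := by
    rw [← mlieBracketWithin_univ, mlieBracketWithin_eq_lieBracketWithin]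
    refine (congrFun (lieBracketWithin_univ (𝕜 := ℝ) (V := fun ξ => frameCoord e u ξ k)
      (W := fun ξ => frameCoord e u ξ l)) (e x)).trans ?_
    change fderiv ℝ (fun ξ => frameCoord e u ξ l) (e x) (frameCoord e u (e x) k) -
      fderiv ℝ (fun ξ => frameCoord e u ξ k) (e x) (frameCoord e u (e x) l) = _
    rw [hd, hd]
    rfl
  rw [structCoeff, ((frame_eventuallyEq_mpullback he hx u k).mlieBracket_vectorField_eq
    (frame_eventuallyEq_mpullback he hx u l)), ← frameCoeff_frameCoord he u hx,
    he.mlieBracket_mpullback hx (hV k) (hV l), h1]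

end Christoffel

/-! ### The canonical connection as a function of the 1-jet -/

section JetFormula

variable {n : ℕ} {E : Type*} [NormedAddCommGroup E] [NormedSpace ℝ E]
  {M : Type*} [TopologicalSpace M] [ChartedSpace E M] [IsManifold 𝓘(ℝ, E) ∞ M]
  {U : TopologicalSpace.Opens M}

/-- The structure functions of a frame field, as functions of its 1-jet in coordinates. -/
def jetStruct {ι : Type*} [Fintype ι] (p : E × (ι → E) × (E →L[ℝ] (ι → E))) (k l m : ι) : ℝ :=
  frameCoeff p.2.1 (p.2.2 (p.2.1 k) l - p.2.2 (p.2.1 l) k) m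

/-- The Christoffel symbols of the canonical connection, as functions of the 1-jet of an adapted
frame field in coordinates. -/
def canonicalChristoffel (v w : E)
    (p : E × (Fin n ⊕ Fin n → E) × (E →L[ℝ] (Fin n ⊕ Fin n → E))) : E :=
  -- With `A = p.2.1` and `L = p.2.2`, `w` is expanded in `A`, and `Γ(v, A_l)` is the coordinate
  -- expression of `∇_v u_l`, given by `canonicalForm`, minus `L v l`.
  ∑ l, frameCoeff p.2.1 w l • ((∑ k, frameCoeff p.2.1 v k •
    ∑ m, canonicalForm (jetStruct p) k m l • p.2.1 m) - p.2.2 v l)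

theorem christoffel_eq_canonicalChristoffel [CompleteSpace E] {x : M}
    {e : OpenPartialHomeomorph M E} (he : IsDiffeo (E := E) e) (hx : x ∈ e.source)
    {u : (y : M) → Frame E (Fin n ⊕ Fin n) y} (hu : ∀ j, CMDiffAt ∞ (T% fun y => u y j) x)
    {D : ConnAt E x} (hD : ∀ k, D.connForm u (u x k) = canonicalForm (structCoeff u x) k)
    (v w : E) : D.christoffel e v w = canonicalChristoffel v w (jetCoord e u x) := by
  have hb := coe_coordBasis he u hx
  have hc : structCoeff u x = jetStruct (jetCoord e u x) := by
    funext k l m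
    exact structCoeff_eq he hx hu k l m
  have hco : ∀ w, (coordBasis he u hx).repr w = frameCoeff (jetCoord e u x).2.1 w := fun w => by
    rw [← frameCoeff_basis, hb]; rfl
  have hv : ⇑((u x).repr ((chartEquiv he hx).symm v)) = frameCoeff (jetCoord e u x).2.1 v := by
    rw [← frameCoeff_frameCoord he u hx, ← chartEquiv_apply he hx,
      ContinuousLinearEquiv.apply_symm_apply]
    rfl
  rw [christoffel_eq_sum he hx D (coordBasis he u hx)]
  simp only [hb, christoffel_frameCoord he hx D hu, hco, canonicalChristoffel, ← hc, ← hD, ← hv]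
  refine Finset.sum_congr rfl fun l _ => ?_
  congr 2
  rw [D.apply_frame, ConnAt.connForm_eq_sum]
  simp only [map_sum, map_smul, chartEquiv_frame, Matrix.sum_apply, Matrix.smul_apply,
    Finset.sum_smul, Finset.smul_sum, smul_assoc]
  exact Finset.sum_comm

theorem contDiffAt_canonicalForm {F : Type*} [NormedAddCommGroup F] [NormedSpace ℝ F] {p : F}
    {c : F → Fin n ⊕ Fin n → Fin n ⊕ Fin n → Fin n ⊕ Fin n → ℝ}
    (hc : ∀ k l m, ContDiffAt ℝ ∞ (fun q => c q k l m) p) (k l m : Fin n ⊕ Fin n) :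
    ContDiffAt ℝ ∞ (fun q => canonicalForm (c q) k l m) p := by
  rcases k with k | k <;> rcases l with l | l <;> rcases m with m | m <;>
    simp only [canonicalForm, Matrix.fromBlocks_apply₁₁, Matrix.fromBlocks_apply₁₂,
      Matrix.fromBlocks_apply₂₁, Matrix.fromBlocks_apply₂₂, Matrix.of_apply, Sum.elim_inl,
      Sum.elim_inr, Matrix.zero_apply] <;>
    first | exact contDiffAt_const | exact hc _ _ _

theorem contDiffAt_canonicalChristoffel (v w : E)
    (p : E × (Fin n ⊕ Fin n → E) × (E →L[ℝ] (Fin n ⊕ Fin n → E)))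
    (b : Module.Basis (Fin n ⊕ Fin n) ℝ E) (hb : p.2.1 = b) :
    ContDiffAt ℝ ∞ (canonicalChristoffel (n := n) v w) p := by
  have h0 : ContDiffAt ℝ ∞ (frameCoeff : (Fin n ⊕ Fin n → E) → _) p.2.1 :=
    hb ▸ contDiffAt_frameCoeff b
  have h1 : ContDiffAt ℝ ∞ (fun q : E × (Fin n ⊕ Fin n → E) ×
      (E →L[ℝ] (Fin n ⊕ Fin n → E)) => frameCoeff q.2.1) p :=
    ContDiffAt.comp (g := frameCoeff) (f := fun q : E × (Fin n ⊕ Fin n → E) ×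
      (E →L[ℝ] (Fin n ⊕ Fin n → E)) => q.2.1) p h0 contDiffAt_snd.fst
  have h2 : ∀ k, ContDiffAt ℝ ∞ (fun q : E × (Fin n ⊕ Fin n → E) ×
      (E →L[ℝ] (Fin n ⊕ Fin n → E)) => q.2.1 k) p := contDiffAt_pi.1 contDiffAt_snd.fst
  have h3 : ContDiffAt ℝ ∞ (fun q : E × (Fin n ⊕ Fin n → E) ×
      (E →L[ℝ] (Fin n ⊕ Fin n → E)) => q.2.2) p := contDiffAt_snd.snd
  have hco : ∀ w l, ContDiffAt ℝ ∞ (fun q : E × (Fin n ⊕ Fin n → E) ×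
      (E →L[ℝ] (Fin n ⊕ Fin n → E)) => frameCoeff q.2.1 w l) p := fun w l =>
    contDiffAt_pi.1 (h1.clm_apply contDiffAt_const) l
  have hst : ∀ k l m, ContDiffAt ℝ ∞ (fun q : E × (Fin n ⊕ Fin n → E) ×
      (E →L[ℝ] (Fin n ⊕ Fin n → E)) => jetStruct q k l m) p := fun k l m =>
    contDiffAt_pi.1 (h1.clm_apply ((contDiffAt_pi.1 (h3.clm_apply (h2 k)) l).sub
      (contDiffAt_pi.1 (h3.clm_apply (h2 l)) k))) m
  refine ContDiffAt.sum fun l _ => (hco w l).smul (ContDiffAt.sub (ContDiffAt.sum fun k _ =>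
    (hco v k).smul (ContDiffAt.sum fun m _ =>
      (contDiffAt_canonicalForm hst k m l).smul (h2 m))) ?_)
  exact contDiffAt_pi.1 (h3.clm_apply contDiffAt_const) l

/-- Smoothness of the jet prolongation of a lift turns smoothness of the jet formula into smoothness
of the connection along a section. -/
theorem contMDiffAt_jetCoord {ι : Type*} [Fintype ι] [CompleteSpace E] {x : M}
    {e : OpenPartialHomeomorph M E} (he : IsDiffeo (E := E) e) (hx : x ∈ e.source)
    {u : (y : M) → Frame E ι y} (hu : ∀ j, CMDiffAt ∞ (T% fun y => u y j) x) :
    ContMDiffAt 𝓘(ℝ, E) 𝓘(ℝ, E × (ι → E) × (E →L[ℝ] (ι → E))) ∞ (jetCoord e u) x := by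
  have hA := contDiffAt_frameCoord he hx hu
  have hg : ContDiffAt ℝ ∞ (fun ξ => (ξ, frameCoord e u ξ, fderiv ℝ (frameCoord e u) ξ)) (e x) :=
    contDiffAt_id.prodMk (hA.prodMk (hA.fderiv_right (by simp)))
  exact hg.contMDiffAt.comp x (he.contMDiffAt hx)

end JetFormula

/-! ### The canonical connection of a section and its functoriality -/

section CanonicalConnection

variable {n : ℕ} {E : Type*} [NormedAddCommGroup E] [NormedSpace ℝ E] [CompleteSpace E]
  {M : Type*} [TopologicalSpace M] [ChartedSpace E M] [IsManifold 𝓘(ℝ, E) ∞ M]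
  {U : TopologicalSpace.Opens M}

theorem existsUnique_isCanonicalAt (s : QuotSection E (deltaGL n) U) (x : U) :
    ∃! D : ConnAt E (x : M), IsCanonicalAt (tensorF s) (tensorP s) D := by
  obtain ⟨u, hu⟩ := s.smooth x
  simp only [isCanonicalAt_iff hu]
  obtain ⟨D, hD⟩ := ConnAt.exists_connForm hu.contMDiffAt (canonicalForm (structCoeff u x))
  exact ⟨D, hD, fun D' hD' => ConnAt.ext_connForm hu.contMDiffAt fun k => by rw [hD, hD']⟩

/-- The value at `x` of the canonical connection. -/
def canonicalAt (s : QuotSection E (deltaGL n) U) (x : U) : ConnAt E (x : M) :=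
  (existsUnique_isCanonicalAt s x).choose

theorem isCanonicalAt_iff_eq (s : QuotSection E (deltaGL n) U) (x : U) (D : ConnAt E (x : M)) :
    IsCanonicalAt (tensorF s) (tensorP s) D ↔ D = canonicalAt s x :=
  ⟨(existsUnique_isCanonicalAt s x).choose_spec.2 D,
    fun h => h ▸ (existsUnique_isCanonicalAt s x).choose_spec.1⟩

theorem isCanonicalAt_canonicalAt (s : QuotSection E (deltaGL n) U) (x : U) :
    IsCanonicalAt (tensorF s) (tensorP s) (canonicalAt s x) :=
  (isCanonicalAt_iff_eq s x _).2 rfl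

/-- Being canonical does not refer to a frame, so the formula is valid in every lift, not only in
the one used for existence. -/
theorem connForm_canonicalAt {s : QuotSection E (deltaGL n) U} {x : U}
    {u : (y : M) → Frame E (Fin n ⊕ Fin n) y} (h : IsLiftNear s.toFun u (x : M))
    (k : Fin n ⊕ Fin n) :
    (canonicalAt s x).connForm u (u x k) = canonicalForm (structCoeff u x) k :=
  (isCanonicalAt_iff h _).1 (isCanonicalAt_canonicalAt s x) k

theorem christoffel_canonicalAt {s : QuotSection E (deltaGL n) U} {x : U}
    {u : (y : M) → Frame E (Fin n ⊕ Fin n) y} (h : IsLiftNear s.toFun u (x : M))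
    {e : OpenPartialHomeomorph M E} (he : IsDiffeo (E := E) e) (hx : (x : M) ∈ e.source)
    (v w : E) :
    (canonicalAt s x).christoffel e v w = canonicalChristoffel v w (jetCoord e u (x : M)) :=
  christoffel_eq_canonicalChristoffel he hx h.contMDiffAt (connForm_canonicalAt h) v w

/-- The canonical connection of a section of `FM/ΔGL(n, ℝ)`. -/
def canonicalConnection (s : QuotSection E (deltaGL n) U) : LinearConnection E U where
  toFun := canonicalAt s
  smooth e he v w x hx := by
    have he' := isDiffeo_of_mem_maximalAtlas he
    obtain ⟨u, hu⟩ := s.smooth x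
    -- A single lift near `x` computes the Christoffel symbols at all nearby points.
    have h1 : CMDiffAt ∞ (fun y : M => canonicalChristoffel v w (jetCoord e u y)) (x : M) :=
      (contDiffAt_canonicalChristoffel v w _ (coordBasis he' u hx)
        (coe_coordBasis he' u hx).symm).contMDiffAt.comp (x : M)
          (contMDiffAt_jetCoord he' hx hu.contMDiffAt)
    have h2 := h1.comp x contMDiff_subtype_val.contMDiffAt
    refine (h2.congr_of_eventuallyEq ?_).contMDiffWithinAt
    have h3 : ∀ᶠ y : U in 𝓝 x, IsLiftNear s.toFun u (y : M) ∧ (y : M) ∈ e.source :=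
      continuous_subtype_val.continuousAt.eventually
        (hu.eventually.and (e.open_source.mem_nhds hx))
    filter_upwards [h3] with y hy
    exact christoffel_canonicalAt hy.1 he' hy.2 v w

theorem isCanonicalConnection_iff_eq (s : QuotSection E (deltaGL n) U) (D : LinearConnection E U) :
    IsCanonicalConnection (tensorF s) (tensorP s) D ↔ D = canonicalConnection s := by
  rw [isCanonicalConnection_iff]
  simp only [isCanonicalAt_iff_eq]
  exact ⟨fun h => LinearConnection.ext (funext h), fun h x => by rw [h]; rfl⟩

theorem canonicalAt_restrict {V : TopologicalSpace.Opens M} (h : V ≤ U)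
    (s : QuotSection E (deltaGL n) U) (x : V) :
    canonicalAt (s.restrict h) x = canonicalAt s ⟨x, h x.2⟩ := by
  obtain ⟨u, hu⟩ := (s.restrict h).smooth x
  have hu' : IsLiftNear s.toFun u (x : M) := by
    obtain ⟨W, hW, hx, hs, hq⟩ := hu
    exact ⟨W, hW.trans h, hx, hs, hq⟩
  refine ConnAt.ext_connForm hu.contMDiffAt fun k => ?_
  rw [connForm_canonicalAt hu]
  exact (connForm_canonicalAt (s := s) (x := ⟨(x : M), h x.2⟩) hu' k).symm

/-- Only the parallelism of `F` and `P` is used: it puts the connection form into the Lie algebra.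
-/
theorem isAdapted_canonicalConnection (s : QuotSection E (deltaGL n) U) :
    IsAdapted s (canonicalConnection s) := by
  intro x u hu v
  have h := isCanonicalAt_canonicalAt s x
  have hF := (parallelAt_iff _ hu.contMDiffAt hu.eventually_tensorF).1 h.1 v
  have hP := (parallelAt_iff _ hu.contMDiffAt hu.eventually_tensorP).1 h.2.1 v
  obtain ⟨B, hB⟩ := (commute_matF_matP_iff _).1 ⟨hF, hP⟩
  exact ⟨_, hB ▸ fromBlocks_mem_lieAlgebra B, fun j => (canonicalAt s x).apply_frame u j v⟩

theorem canonicalAt_eq_of_sameJet {x : M} {s s' : LocalSection E (deltaGL n) x}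
    (h : SameJet E (deltaGL n) x s s') :
    canonicalAt s.sec ⟨x, s.mem⟩ = canonicalAt s'.sec ⟨x, s'.mem⟩ := by
  obtain ⟨u, u', hu, hu', hj⟩ := h
  have he := isDiffeo_of_mem_maximalAtlas (IsManifold.chart_mem_maximalAtlas (I := 𝓘(ℝ, E))
    (n := ∞) x)
  have hx := mem_chart_source E x
  have hc : ∀ v w, (canonicalAt s.sec ⟨x, s.mem⟩).christoffel (chartAt E x) v w =
      (canonicalAt s'.sec ⟨x, s'.mem⟩).christoffel (chartAt E x) v w := fun v w => by
    rw [christoffel_canonicalAt hu he hx, christoffel_canonicalAt hu' he hx, hj]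
  -- Equal Christoffel symbols give equal connections. The field `u` is chosen as a lift of `s`
  -- alone, but any smooth frame can test both connections.
  refine ConnAt.ext_frame hu.contMDiffAt fun l => ContinuousLinearMap.ext fun v => ?_
  have h := hc (chartEquiv he hx v) (frameCoord (chartAt E x) u (chartAt E x x) l)
  rw [christoffel_frameCoord he hx _ hu.contMDiffAt, christoffel_frameCoord he hx _ hu.contMDiffAt,
    sub_left_inj, ContinuousLinearEquiv.symm_apply_apply] at h
  exact (chartEquiv he hx).injective h

/-- The fibred map `J¹(FM/ΔGL(n, ℝ)) → C(M)` defined by the canonical connection. -/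
def canonicalJetMap (x : M) : Jet E (deltaGL n) x → ConnAt E x :=
  Quot.lift (fun s => canonicalAt s.sec ⟨x, s.mem⟩) fun _ _ h => canonicalAt_eq_of_sameJet h

theorem isSmoothJetMap_canonicalJetMap [FiniteDimensional ℝ E]
    (hn : Fintype.card (Fin n ⊕ Fin n) = Module.finrank ℝ E) :
    IsSmoothJetMap (E := E) (M := M) (G := deltaGL n) canonicalJetMap := by
  intro e he v w
  refine ⟨canonicalChristoffel v w, fun p hp => ?_, fun U s x u hx hu =>
    christoffel_canonicalAt hu (isDiffeo_of_mem_maximalAtlas he) hx v w⟩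
  -- Membership in `jetDomain` gives only linear independence; the dimension count `hn` makes the
  -- family a basis.
  exact (contDiffAt_canonicalChristoffel v w p
    (basisOfLinearIndependentOfCardEqFinrank' p.2.1 hp.2 hn) (by simp)).contDiffWithinAt

/-! ### Naturality under local diffeomorphisms -/

section Naturality

variable {φ : OpenPartialHomeomorph M M} (hφ : IsDiffeo (E := E) φ)
include hφ

open Classical in
/-- The frame field `φ^* u'`, which agrees with `w` away from the source of `φ`. -/
def pullbackFrame {ι : Type*} (u' w : (y : M) → Frame E ι y) (y : M) : Frame E ι y :=
  if hy : y ∈ φ.source then (u' (φ y)).map (hφ.tangentEquiv hy).symm.toLinearEquiv else w y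

variable {ι : Type*} (u' w : (y : M) → Frame E ι y)

omit [CompleteSpace E] [IsManifold 𝓘(ℝ, E) ∞ M] in
theorem pullbackFrame_eq {y : M} (hy : y ∈ φ.source) :
    pullbackFrame hφ u' w y = (u' (φ y)).map (hφ.tangentEquiv hy).symm.toLinearEquiv :=
  dif_pos hy

omit [CompleteSpace E] [IsManifold 𝓘(ℝ, E) ∞ M] in
theorem pullbackFrame_apply {y : M} (hy : y ∈ φ.source) (j : ι) :
    pullbackFrame hφ u' w y j = mpullback 𝓘(ℝ, E) 𝓘(ℝ, E) φ (fun z => u' z j) y := by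
  rw [pullbackFrame_eq hφ u' w hy, hφ.mpullback_eq hy]
  rfl

omit [CompleteSpace E] [IsManifold 𝓘(ℝ, E) ∞ M] in
theorem mfderiv_pullbackFrame {y : M} (hy : y ∈ φ.source) (j : ι) :
    mfderiv 𝓘(ℝ, E) 𝓘(ℝ, E) φ y (pullbackFrame hφ u' w y j) = u' (φ y) j := by
  rw [pullbackFrame_apply hφ u' w hy, hφ.mfderiv_mpullback hy]

omit [CompleteSpace E] [IsManifold 𝓘(ℝ, E) ∞ M] in
theorem repr_pullbackFrame {y : M} (hy : y ∈ φ.source) (v : TangentSpace 𝓘(ℝ, E) y) :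
    (pullbackFrame hφ u' w y).repr v =
      (u' (φ y)).repr (mfderiv 𝓘(ℝ, E) 𝓘(ℝ, E) φ y v) := by
  rw [pullbackFrame_eq hφ u' w hy]
  rfl

theorem structCoeff_pullbackFrame [Fintype ι] {x : M} (hx : x ∈ φ.source)
    (hu' : ∀ j, CMDiffAt ∞ (T% fun y => u' y j) (φ x)) (k l m : ι) :
    structCoeff (pullbackFrame hφ u' w) x k l m = structCoeff u' (φ x) k l m := by
  have h : ∀ j, (fun y => pullbackFrame hφ u' w y j) =ᶠ[𝓝 x]
      mpullback 𝓘(ℝ, E) 𝓘(ℝ, E) φ (fun z => u' z j) := fun j => by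
    filter_upwards [φ.open_source.mem_nhds hx] with y hy using pullbackFrame_apply hφ u' w hy j
  rw [structCoeff, (h k).mlieBracket_vectorField_eq (h l), repr_pullbackFrame hφ u' w hx,
    hφ.mlieBracket_mpullback hx (ConnAt.mdifferentiableAt_frame hu' k)
      (ConnAt.mdifferentiableAt_frame hu' l)]
  rfl

/-- Starting from a lift of `s'` and pulling it back produces matching adapted frames on both sides
of `φ`. -/
theorem isLiftNear_pullbackFrame {s : QuotSection E (deltaGL n) (srcOpens φ)}
    {s' : QuotSection E (deltaGL n) (tgtOpens φ)} (ht : IsTransport φ s s') {x : M}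
    (hx : x ∈ φ.source) {u' : (y : M) → Frame E (Fin n ⊕ Fin n) y}
    (hu' : IsLiftNear s'.toFun u' (φ x)) (w : (y : M) → Frame E (Fin n ⊕ Fin n) y) :
    IsLiftNear s.toFun (pullbackFrame hφ u' w) x := by
  have h1 : ∀ᶠ y in 𝓝 x, y ∈ φ.source ∧ IsLiftNear s'.toFun u' (φ y) :=
    Filter.Eventually.and (φ.open_source.mem_nhds hx) ((φ.continuousAt hx).eventually hu'.eventually)
  obtain ⟨V, hV, hVo, hxV⟩ := eventually_nhds_iff.1 h1
  refine ⟨⟨V, hVo⟩, fun y hy => (hV y hy).1, hxV, fun j y hy => ?_, fun y => ?_⟩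
  · obtain ⟨hys, hyl⟩ := hV y hy
    have h2 := hφ.contMDiffAt_mpullback hys (hyl.contMDiffAt j)
    refine (h2.congr_of_eventuallyEq ?_).contMDiffWithinAt
    filter_upwards [φ.open_source.mem_nhds hys] with z hz
    rw [pullbackFrame_apply hφ u' w hz]
  · obtain ⟨hys, hyl⟩ := hV y y.2
    exact (ht ⟨y, hys⟩ _ (u' (φ y)) fun j => (mfderiv_pullbackFrame hφ u' w hys j).symm).2
      (hyl.eq_coset (φ.map_source hys))

/-- A diffeomorphism carries connections into each other if their connection forms in frame fields
that it carries into each other agree. -/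
theorem apply_mfderiv_of_connForm [Fintype ι] {x : M} (hx : x ∈ φ.source) (D : ConnAt E x)
    (D' : ConnAt E (φ x)) (hu : ∀ j, CMDiffAt ∞ (T% fun y => pullbackFrame hφ u' w y j) x)
    (hu' : ∀ j, CMDiffAt ∞ (T% fun y => u' y j) (φ x))
    (hD : ∀ k, D'.connForm u' (u' (φ x) k) =
      D.connForm (pullbackFrame hφ u' w) (pullbackFrame hφ u' w x k))
    {Y : (y : M) → TangentSpace 𝓘(ℝ, E) y} (hY : MDiffAt (T% Y) (φ x))
    (v : TangentSpace 𝓘(ℝ, E) x) :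
    D'.toFun Y (mfderiv 𝓘(ℝ, E) 𝓘(ℝ, E) φ x v) =
      mfderiv 𝓘(ℝ, E) 𝓘(ℝ, E) φ x (D.toFun (mpullback 𝓘(ℝ, E) 𝓘(ℝ, E) φ Y) v) := by
  set u := pullbackFrame hφ u' w with hu_def
  have hrepr : ∀ v : TangentSpace 𝓘(ℝ, E) x,
      (u' (φ x)).repr (mfderiv 𝓘(ℝ, E) 𝓘(ℝ, E) φ x v) = (u x).repr v := fun v =>
    (repr_pullbackFrame hφ u' w hx v).symm
  have hform : D'.connForm u' (mfderiv 𝓘(ℝ, E) 𝓘(ℝ, E) φ x v) = D.connForm u v := by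
    rw [D.connForm_eq_sum u v, D'.connForm_eq_sum, hrepr]
    simp only [hD]
  have hYx := hφ.mdifferentiableAt_mpullback hx hY
  -- The coefficients of `φ^* Y` in the pulled-back frame are those of `Y` composed with `φ`; the
  -- chain rule compares their differentials.
  have hcoef : ∀ m, d% (fun y => (u y).repr (mpullback 𝓘(ℝ, E) 𝓘(ℝ, E) φ Y y) m) x v =
      d% (fun z => (u' z).repr (Y z) m) (φ x) (mfderiv 𝓘(ℝ, E) 𝓘(ℝ, E) φ x v) := by
    intro m
    have h1 : (fun y => (u y).repr (mpullback 𝓘(ℝ, E) 𝓘(ℝ, E) φ Y y) m) =ᶠ[𝓝 x]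
        (fun z => (u' z).repr (Y z) m) ∘ φ := by
      filter_upwards [φ.open_source.mem_nhds hx] with y hy
      rw [hu_def, repr_pullbackFrame hφ u' w hy, hφ.mfderiv_mpullback hy]
      rfl
    have h2 := mfderiv_comp x (mdifferentiableAt_repr hu' hY m)
      ((hφ.contMDiffAt hx).mdifferentiableAt (by simp))
    have h3 := h1.mfderiv_eq (I := 𝓘(ℝ, E)) (I' := 𝓘(ℝ, ℝ))
    exact DFunLike.congr_fun (h3.trans h2) v
  refine (u' (φ x)).repr.injective (DFunLike.coe_injective ?_)
  rw [hrepr, D'.repr_apply hu' hY, D.repr_apply hu hYx, hform, ← hrepr, hφ.mfderiv_mpullback hx]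
  simp only [hcoef]

theorem isDirectImage_canonicalConnection {s : QuotSection E (deltaGL n) (srcOpens φ)}
    {s' : QuotSection E (deltaGL n) (tgtOpens φ)} (ht : IsTransport φ s s') :
    IsDirectImage φ (canonicalConnection s) (canonicalConnection s') := by
  intro x Y hY v
  -- `w` only fills in the values of the pulled-back frame off the source of `φ`, so any frame field
  -- will do.
  obtain ⟨w, -⟩ := s.smooth x
  obtain ⟨u', hu'⟩ := s'.smooth (imgPt φ x)
  have hu := isLiftNear_pullbackFrame hφ ht x.2 hu' w
  refine apply_mfderiv_of_connForm hφ u' w x.2 (canonicalAt s x) (canonicalAt s' (imgPt φ x))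
    hu.contMDiffAt hu'.contMDiffAt (fun k => ?_) hY v
  have hst : structCoeff (pullbackFrame hφ u' w) (x : M) = structCoeff u' (φ x) := by
    funext k l m
    exact structCoeff_pullbackFrame hφ u' w x.2 hu'.contMDiffAt k l m
  rw [connForm_canonicalAt hu, hst]
  exact connForm_canonicalAt (x := imgPt φ x) hu' k

end Naturality

theorem isFunctorialConnection_canonicalConnection [FiniteDimensional ℝ E]
    (hn : Fintype.card (Fin n ⊕ Fin n) = Module.finrank ℝ E) :
    IsFunctorialConnection (E := E) (M := M) (G := deltaGL n)
      fun _ s => canonicalConnection s where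
  restrict h s x := canonicalAt_restrict h s x
  adapted := isAdapted_canonicalConnection
  natural _ hφ hφ' _ _ ht := isDirectImage_canonicalConnection ⟨hφ, hφ'⟩ ht
  factors := ⟨canonicalJetMap, fun _ _ _ => rfl, isSmoothJetMap_canonicalJetMap hn⟩

end CanonicalConnection

end Functorial

end

theorem mainTheorem4 (n : ℕ) (M : Type*) [TopologicalSpace M] [T2Space M]
    [SecondCountableTopology M] [ChartedSpace (EuclideanSpace ℝ (Fin (2 * n))) M]
    [IsManifold 𝓘(ℝ, EuclideanSpace ℝ (Fin (2 * n))) ∞ M] :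
    ∃ nabla : (U : TopologicalSpace.Opens M) →
        Functorial.QuotSection (EuclideanSpace ℝ (Fin (2 * n))) (Functorial.deltaGL n) U →
        Functorial.LinearConnection (EuclideanSpace ℝ (Fin (2 * n))) U,
      (∀ (U : TopologicalSpace.Opens M)
          (σ : Functorial.QuotSection (EuclideanSpace ℝ (Fin (2 * n)))
            (Functorial.deltaGL n) U)
          (D : Functorial.LinearConnection (EuclideanSpace ℝ (Fin (2 * n))) U),
        Functorial.IsCanonicalConnection (Functorial.tensorF σ) (Functorial.tensorP σ) D ↔
          D = nabla U σ) ∧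
      Functorial.IsFunctorialConnection nabla := by
  exact ⟨fun _ s => Functorial.canonicalConnection s,
    fun _ s D => Functorial.isCanonicalConnection_iff_eq s D,
    Functorial.isFunctorialConnection_canonicalConnection (by simp; omega)⟩
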